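/- **Setting.** All logarithms are to base $2$. For $x\in\{0,1\}^n$ and $S\subseteq[n]$ let $x^{(S)}$ be $x$ with the coordinates in $S$ flipped, and $x^{(i)}=x^{(\{i\})}$. Let $f:\{0,1\}^n\to\{0,1\}$. The edge $(x,x^{(i)})$ in direction $i$ is bi-chromatic if $f(x)\ne f(x^{(i)})$; a bi-chromatic edge is monotone if $f(x)=x_i$ and anti-monotone otherwise. An *edge violation* (of unateness) of $f$ consists of a monotone edge and an anti-monotone edge of $f$ in the same direction. *Adaptive edge search.* $\textsc{AE-Search}(x,S)$, for nonempty $S\subseteq[n]$, queries $b=f(x)$, draws $L=\lceil 4\log n\rceil$ independent uniformly random subsets $T_1,\dots,T_L\subseteq S$ of size $\lfloor(|S|-1)/2\rfloor+1$, and queries $b_\ell=f(x^{(T_\ell)})$ for each $\ell$. Let $C=\bigcap_{\ell:\,b_\ell\neq b}T_\ell$, with $C=\emptyset$ if all $b_\ell=b$. If $C=\{i\}$, it queries $f(x^{(i)})$ and, if this differs from $b$, returns $i$ and the edge $(x,x^{(i)})$ (with its kind, monotone or anti-monotone). In all other cases it returns "nil". *Scores.* For $i\in[n]$ and $j\ge1$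 let $\mathcal P_{i,j}$ be the family of subsets of $[n]\setminus\{i\}$ of size $2^j-1$. A pair $(x,S)$ is good for $E_i^+$ (for $E_i^-$) if $(x,x^{(i)})$ is a monotone (anti-monotone) edge of $f$ and $\textsc{AE-Search}(x,S\cup\{i\})$ returns $i$ with probability at least $1/2$. A point $x$ is $j$-strong for $E_i^{\pm}$ if $(x,S)$ is good for $E_i^{\pm}$ for at least $3/4$ of the sets $S\in\mathcal P_{i,j}$. $\textsc{Score}_{i,j}^{\pm}$ is the fraction of points $x\in\{0,1\}^n$ that are $j$-strong for $E_i^\pm$. For an integer $\Lambda\ge0$ with $2^\Lambda\le\sqrt n$, let $$\textsc{Score}_i^{\pm}=\max_{1\le j\le\Lambda}\ \textsc{Score}_{i,j}^{\pm}\cdot\frac{2^j}{\sqrt n}$$ (and $0$ if $\Lambda=0$). For a constant $c>0$, the *score condition* is $$\sum_{i=1}^n\min\{\textsc{Score}_i^+,\textsc{Score}_i^-\}\ \ge\ c\,\frac{\epsilon^2}{\log^8 n}.$$ **Theorem.** For every constant $c>0$ there is a constant $C>0$ such that for all integers $n\ge2$ and all $\epsilon\in(0,1]$ there is a randomized adaptive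 query algorithm (depending only on $c$, $n$ and $\epsilon$), whose only access to the unknown function $f:\{0,1\}^n\to\{0,1\}$ is through calls of $\textsc{AE-Search}$, with the following properties. 1. For every $f$, every outcome of its random choices and all answers, it makes at most $$C\cdot\frac{n^{3/4}}{\epsilon^2}\cdot\log^{16}n\cdot\log^2(n/\epsilon)$$ queries to $f$. 2. It is one-sided: for every $f$, whenever it outputs a pair of edges, that pair is an edge violation of $f$. 3. For every $\Lambda$ with $2^\Lambda\le\sqrt n$ and every $f$ that satisfies the score condition with constant $c$, it outputs an edge violation of $f$ with probability at least $2/3$. Moreover, the query bound is $\widetilde O(n^{3/4}/\epsilon^2)$: there are constants $D>0$ and $k$ such that for all $n\ge2$ and $\epsilon\in(0,1]$, with $g=n^{3/4}/\epsilon^2$, one has $g\cdot\log^{16}n\cdot\log^2(n/\epsilon)\le D\,g\,\log^k g$. -/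

import Mathlib

open scoped NNReal ENNReal

/-- Points of the Boolean hypercube `{0,1}^n`. -/
abbrev Cube (n : ℕ) : Type := Fin n → Bool

/-- `x^(S)`: the point `x` with the coordinates in `S` flipped. -/
def flipSet {n : ℕ} (x : Cube n) (S : Finset (Fin n)) : Cube n :=
  fun i => if i ∈ S then !(x i) else x i

/-- The two kinds of bi-chromatic edges. -/
inductive EdgeKind : Type
  | monotone
  | antiMonotone

/-- The kind that a bi-chromatic edge `(x, x^(i))` has when `f x = b`: it is monotone if `b = x i`
and anti-monotone otherwise. -/
def edgeKind {n : ℕ} (x : Cube n) (i : Fin n) (b : Bool) : EdgeKind :=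
  if b = x i then EdgeKind.monotone else EdgeKind.antiMonotone

/-- `(x, x^(i))` is a bi-chromatic edge of `f` of kind `κ`. -/
def IsEdge {n : ℕ} (f : Cube n → Bool) (κ : EdgeKind) (i : Fin n) (x : Cube n) : Prop :=
  f x ≠ f (flipSet x {i}) ∧ edgeKind x i (f x) = κ

/-- Two edges `(x, x^(dir))`, `(y, y^(dir))` in a common direction. -/
structure EdgePair (n : ℕ) : Type where
  dir : Fin n
  x : Cube n
  y : Cube n

/-- The pair is an edge violation of unateness: the first edge is a monotone edge of `f`, the
second one is an anti-monotone edge of `f` in the same direction. -/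
def EdgePair.IsViolation {n : ℕ} (v : EdgePair n) (f : Cube n → Bool) : Prop :=
  IsEdge f EdgeKind.monotone v.dir v.x ∧ IsEdge f EdgeKind.antiMonotone v.dir v.y

/-- Randomized adaptive query algorithms with output in `β`: at each step the algorithm stops with
an output, queries the unknown function at a point, or draws a uniformly random element of a finite
nonempty type; it continues depending on the outcome. -/
inductive QueryAlg (n : ℕ) (β : Type) : Type 1
  | ret (a : β) : QueryAlg n β
  | query (x : Cube n) (k : Bool → QueryAlg n β) : QueryAlg n β
  | uniform (ι : Type) [fin : Fintype ι] [ne : Nonempty ι] (k : ι → QueryAlg n β) : QueryAlg n β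

namespace QueryAlg

/-- Sequential composition. -/
def bind {n : ℕ} {β γ : Type} : QueryAlg n β → (β → QueryAlg n γ) → QueryAlg n γ
  | ret a, g => g a
  | query x k, g => query x fun b => (k b).bind g
  | uniform ι k, g => uniform ι fun i => (k i).bind g

/-- The output distribution when the queries are answered by `f`. -/
noncomputable def run {n : ℕ} {β : Type} (f : Cube n → Bool) : QueryAlg n β → PMF β
  | ret a => PMF.pure a
  | query x k => (k (f x)).run f
  | uniform ι k => (PMF.uniformOfFintype ι).bind fun i => (k i).run f

/-- The number of queries in the worst case, over all answers and all random choices. -/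
def queries {n : ℕ} {β : Type} : QueryAlg n β → ℕ
  | ret _ => 0
  | query _ k => 1 + max (k false).queries (k true).queries
  | uniform _ k => Finset.univ.sup fun i => (k i).queries

/-- Query a finite sequence of points and return the answers. -/
def queryAll {n : ℕ} : (L : ℕ) → (Fin L → Cube n) → QueryAlg n (Fin L → Bool)
  | 0, _ => ret Fin.elim0
  | L + 1, xs => query (xs 0) fun b =>
      (queryAll L fun l => xs l.succ).bind fun bs => ret (Fin.cons b bs)

end QueryAlg

open Classical in
/-- The last steps of adaptive edge search: `b = f x`, and `bs l = f (x^(T l))` are the answers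
for the random sets. Let `C` be the intersection of the sets `T l` with `bs l ≠ b` (empty if there
are none). If `C = {i}`, query `x^(i)`, and return `i`, with the kind of the edge `(x, x^(i))`,
if that edge is bi-chromatic; return `none` in all other cases. -/
noncomputable def aeFinish {n L : ℕ} (x : Cube n) (b : Bool) (T : Fin L → Finset (Fin n))
    (bs : Fin L → Bool) : QueryAlg n (Option (Fin n × EdgeKind)) :=
  let C : Finset (Fin n) :=
    Finset.univ.filter fun i => (∃ l, bs l ≠ b) ∧ ∀ l, bs l ≠ b → i ∈ T l
  if h : ∃ i, C = {i} then
    QueryAlg.query (flipSet x {h.choose}) fun b' =>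
      QueryAlg.ret (if b' ≠ b then some (h.choose, edgeKind x h.choose b) else none)
  else QueryAlg.ret none

/-- Adaptive edge search `AE-Search(x, S)` for nonempty `S`: query `x`, draw `⌈4 log n⌉` independent
uniformly random subsets of `S` of size `⌊(|S| - 1) / 2⌋ + 1`, query `x` flipped on each of them,
and proceed as in `aeFinish`. -/
noncomputable def aeSearch {n : ℕ} (x : Cube n) (S : Finset (Fin n)) :
    QueryAlg n (Option (Fin n × EdgeKind)) :=
  if h : S.Nonempty then
    haveI : Nonempty {T : Finset (Fin n) // T ∈ S.powersetCard ((S.card - 1) / 2 + 1)} := by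
      have hc := h.card_pos
      obtain ⟨T, hT⟩ := Finset.powersetCard_nonempty.2
        (show (S.card - 1) / 2 + 1 ≤ S.card by omega)
      exact ⟨⟨T, hT⟩⟩
    QueryAlg.query x fun b =>
      QueryAlg.uniform
        (Fin ⌈4 * Real.logb 2 n⌉₊ →
          {T : Finset (Fin n) // T ∈ S.powersetCard ((S.card - 1) / 2 + 1)}) fun T =>
        (QueryAlg.queryAll _ fun l => flipSet x (T l).1).bind fun bs =>
          aeFinish x b (fun l => (T l).1) bs
  else QueryAlg.ret none

/-- The algorithm is built from adaptive edge search: it has no access to the unknown function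
other than by calls of `aeSearch`. -/
inductive BuiltFromAESearch {n : ℕ} {β : Type} : QueryAlg n β → Prop
  | ret (a : β) : BuiltFromAESearch (QueryAlg.ret a)
  | uniform (ι : Type) [Fintype ι] [Nonempty ι] (k : ι → QueryAlg n β)
      (hk : ∀ i, BuiltFromAESearch (k i)) : BuiltFromAESearch (QueryAlg.uniform ι k)
  | search (x : Cube n) (S : Finset (Fin n)) (k : Option (Fin n × EdgeKind) → QueryAlg n β)
      (hk : ∀ o, BuiltFromAESearch (k o)) : BuiltFromAESearch ((aeSearch x S).bind k)

/-- `(x, S)` is a good pair for `E_i^+` (monotone edges) or `E_i^-` (anti-monotone edges):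
`(x, x^(i))` is an edge of that kind, and `AE-Search(x, S ∪ {i})` returns `i` with probability at
least `1/2`. -/
def IsGoodPair {n : ℕ} (f : Cube n → Bool) (κ : EdgeKind) (i : Fin n) (x : Cube n)
    (S : Finset (Fin n)) : Prop :=
  IsEdge f κ i x ∧
    1 / 2 ≤ ((aeSearch x (insert i S)).run f).toOuterMeasure {o | ∃ κ', o = some (i, κ')}

/-- `P_{i,j}`: the subsets of `[n] \ {i}` of size `2^j - 1`. -/
def scaleSets {n : ℕ} (i : Fin n) (j : ℕ) : Finset (Finset (Fin n)) :=
  (Finset.univ.erase i).powersetCard (2 ^ j - 1)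

open Classical in
/-- `x` is `j`-strong for `E_i^+` or `E_i^-`: `(x, S)` is a good pair for at least `3/4` of the sets
`S` in `P_{i,j}`. -/
def IsStrong {n : ℕ} (f : Cube n → Bool) (κ : EdgeKind) (i : Fin n) (j : ℕ) (x : Cube n) : Prop :=
  (3 / 4 : ℝ) * (scaleSets i j).card ≤ ((scaleSets i j).filter fun S => IsGoodPair f κ i x S).card

open Classical in
/-- `Score_{i,j}^±`: the fraction of points that are `j`-strong. -/
noncomputable def scoreAt {n : ℕ} (f : Cube n → Bool) (κ : EdgeKind) (i : Fin n) (j : ℕ) : ℝ≥0 :=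
  ((Finset.univ.filter fun x : Cube n => IsStrong f κ i j x).card : ℝ≥0) / 2 ^ n

/-- `Score_i^±`: the maximum of `Score_{i,j}^± · 2^j / √n` over the scales `j ∈ {1, …, Λ}`. -/
noncomputable def score {n : ℕ} (f : Cube n → Bool) (Λ : ℕ) (κ : EdgeKind) (i : Fin n) : ℝ≥0 :=
  (Finset.Icc 1 Λ).sup fun j => scoreAt f κ i j * (2 ^ j / NNReal.sqrt n)

/-- The score condition with constant `c`:
`∑_i min (Score_i^+) (Score_i^-) ≥ c ε² / log^8 n`. -/
def ScoreCondition {n : ℕ} (c ε : ℝ) (Λ : ℕ) (f : Cube n → Bool) : Prop :=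
  c * ε ^ 2 / Real.logb 2 n ^ 8 ≤
    ∑ i : Fin n, ((min (score f Λ EdgeKind.monotone i) (score f Λ EdgeKind.antiMonotone i) : ℝ≥0) : ℝ)

/-- `(n^{3/4} / ε²) · log^16 n · log²(n/ε)`. -/
noncomputable def queryBound (n : ℕ) (ε : ℝ) : ℝ :=
  (n : ℝ) ^ (3 / 4 : ℝ) / ε ^ 2 * Real.logb 2 n ^ 16 * Real.logb 2 (n / ε) ^ 2

/-! The algorithm is a birthday-paradox search for one direction carrying edges of both kinds. Draw
a random `S` of size `2 ^ j`, record the directions of the kind-`b` edges found by `M` searches in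
`S`, then run `M` searches for kind `!b` in random subsets of `S` of size `2 ^ k`. With `p i`, `q i`
the probabilities that one search of either sort hits direction `i`, the weight of `S` is the sum
over `i ∈ S` of `min (p i) (q i)`. Only the `2 ^ j ≤ √n` directions of `S` compete, so by
Cauchy-Schwarz a collision has constant probability once `M` times the weight is at least `n^(1/4)`
(`expect_gather_le`, `prod_le_of_card_le`, `failure_trial_le`).

The scores bound the mean weight from below. For a direction `i`, let `j ≥ k` be the scales
attaining its two scores. A random `S` contains `i` with probability `2 ^ j / n`, and a random `2 ^
k`-subset of such an `S` contains `i` with probability `2 ^ k / 2 ^ j`. Each threshold `3/4` in the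
definition of strong points loses at most a quarter, so both searches are effective together on
average: normalized quantities in `[0, 1]` with means at least `3/4` satisfy `E[a + b - 1] ≥ 1/2`
(`min_scoreAt_le_average`). Summing over directions and scales gives total mean weight at least `1 /
(4D)`, where `D = log^8 n · √n / (c ε²)` (`sum_min_score_le`).

How the weight is distributed is unknown, so all dyadic levels `2^(-h)` are tried: about `2^(-h) D`
trials with `n^(1/4) 2^h` searches each. The product does not depend on `h`, apart from rounding,
and is about `D n^(1/4)`, which is `n^(3/4) / ε²` up to logarithms. Failure probabilities of
independent trials multiply, so the contributions of all scales and levels add up in one exponent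
(`failure_violationSearch_le`).

One-sidedness holds because adaptive edge search checks every edge that it returns. -/

/-! ### Expectations, supports and query counts of algorithms -/

namespace QueryAlg

variable {n : ℕ} {β γ : Type}

/-- The expectation of `g` of the output when the queries are answered by `f`. -/
noncomputable def expect (f : Cube n → Bool) : QueryAlg n β → (β → ℝ) → ℝ
  | ret a, g => g a
  | query x k, g => expect f (k (f x)) g
  | uniform ι k, g => (∑ i, expect f (k i) g) / Fintype.card ι

theorem expect_bind (f : Cube n → Bool) (A : QueryAlg n β) (B : β → QueryAlg n γ) (g : γ → ℝ) :
    (A.bind B).expect f g = A.expect f fun b => (B b).expect f g := by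
  induction A with
  | ret a => rfl
  | query x k ih => exact ih _
  | uniform ι k ih => simp only [bind, expect, ih]

theorem run_bind (f : Cube n → Bool) (A : QueryAlg n β) (B : β → QueryAlg n γ) :
    (A.bind B).run f = (A.run f).bind fun b => (B b).run f := by
  induction A with
  | ret a => simp [bind, run]
  | query x k ih => exact ih _
  | uniform ι k ih => simp only [bind, run, ih, PMF.bind_bind]

theorem mem_support_run_bind {f : Cube n → Bool} {A : QueryAlg n β} {B : β → QueryAlg n γ} {c : γ} :
    c ∈ ((A.bind B).run f).support ↔ ∃ b ∈ (A.run f).support, c ∈ ((B b).run f).support := by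
  rw [run_bind, PMF.mem_support_bind_iff]

theorem mem_support_run_uniform {f : Cube n → Bool} {ι : Type} {_ : Fintype ι}
    {_ : Nonempty ι} {k : ι → QueryAlg n β} {b : β} :
    b ∈ ((uniform ι k).run f).support ↔ ∃ i, b ∈ ((k i).run f).support := by
  rw [run, PMF.mem_support_bind_iff]
  simp

theorem mem_support_run_ret {f : Cube n → Bool} {a b : β} :
    b ∈ ((ret a : QueryAlg n β).run f).support ↔ b = a := by
  simp [run]

/-- Comparison on the support alone lets one-sidedness enter estimates of probabilities. -/
theorem expect_mono_support {f : Cube n → Bool} {A : QueryAlg n β} {g g' : β → ℝ}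
    (h : ∀ b ∈ (A.run f).support, g b ≤ g' b) : A.expect f g ≤ A.expect f g' := by
  induction A with
  | ret a => exact h a (by simp [run])
  | query x k ih => exact ih _ h
  | uniform ι k ih =>
    simp only [expect]
    gcongr with i
    exact ih i fun b hb => h b (mem_support_run_uniform.2 ⟨i, hb⟩)

theorem expect_mono {f : Cube n → Bool} {A : QueryAlg n β} {g g' : β → ℝ}
    (h : ∀ b, g b ≤ g' b) : A.expect f g ≤ A.expect f g' :=
  expect_mono_support fun b _ => h b

theorem expect_const (f : Cube n → Bool) (A : QueryAlg n β) (c : ℝ) :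
    A.expect f (fun _ => c) = c := by
  induction A with
  | ret a => rfl
  | query x k ih => exact ih _
  | uniform ι k ih => simp [expect, ih]

theorem expect_const_mul (f : Cube n → Bool) (A : QueryAlg n β) (c : ℝ) (g : β → ℝ) :
    A.expect f (fun b => c * g b) = c * A.expect f g := by
  induction A with
  | ret a => rfl
  | query x k ih => exact ih _
  | uniform ι k ih => simp only [expect, ih, ← Finset.mul_sum, mul_div_assoc]

theorem expect_add (f : Cube n → Bool) (A : QueryAlg n β) (g g' : β → ℝ) :
    A.expect f (fun b => g b + g' b) = A.expect f g + A.expect f g' := by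
  induction A with
  | ret a => rfl
  | query x k ih => exact ih _
  | uniform ι k ih => simp only [expect, ih, Finset.sum_add_distrib, add_div]

theorem expect_sub (f : Cube n → Bool) (A : QueryAlg n β) (g g' : β → ℝ) :
    A.expect f (fun b => g b - g' b) = A.expect f g - A.expect f g' := by
  have h := expect_add f A (fun b => g b - g' b) g'
  simp only [sub_add_cancel] at h
  linarith

theorem expect_sum (f : Cube n → Bool) (A : QueryAlg n β) {ι : Type*} (s : Finset ι)
    (g : ι → β → ℝ) :
    A.expect f (fun b => ∑ i ∈ s, g i b) = ∑ i ∈ s, A.expect f (g i) := by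
  classical
  induction s using Finset.induction_on with
  | empty => simp [expect_const]
  | insert i s hi ih => simp only [Finset.sum_insert hi, expect_add, ih]

theorem expect_nonneg {f : Cube n → Bool} {A : QueryAlg n β} {g : β → ℝ} (h : ∀ b, 0 ≤ g b) :
    0 ≤ A.expect f g := by
  simpa [expect_const] using expect_mono (f := f) (A := A) h

-- Goodness and the final success bound are stated with outer measures in `ℝ≥0∞`; this identity
-- transfers them to real expectations.
open Classical in
theorem toOuterMeasure_run (f : Cube n → Bool) (A : QueryAlg n β) (s : Set β) :
    (A.run f).toOuterMeasure s = ENNReal.ofReal (A.expect f fun b => if b ∈ s then 1 else 0) := by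
  induction A with
  | ret a =>
    simp only [run, expect, PMF.toOuterMeasure_pure_apply]
    split_ifs <;> simp
  | query x k ih => exact ih _
  | uniform ι k ih =>
    simp only [run, expect, PMF.toOuterMeasure_bind_apply, ih, PMF.uniformOfFintype_apply]
    rw [tsum_fintype, ← Finset.mul_sum, ← ENNReal.ofReal_sum_of_nonneg, mul_comm,
      ENNReal.ofReal_div_of_pos, ENNReal.ofReal_natCast, ENNReal.div_eq_inv_mul, mul_comm]
    · exact_mod_cast Fintype.card_pos
    · exact fun i _ => expect_nonneg fun b => by split_ifs <;> simp

theorem queries_bind_le {A : QueryAlg n β} {B : β → QueryAlg n γ} {m : ℕ}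
    (h : ∀ b, (B b).queries ≤ m) : (A.bind B).queries ≤ A.queries + m := by
  induction A with
  | ret a => simpa [bind, queries] using h a
  | query x k ih =>
    have h₀ := ih false
    have h₁ := ih true
    simp only [bind, queries]
    omega
  | uniform ι k ih =>
    simp only [bind, queries]
    refine Finset.sup_le fun i _ => (ih i).trans ?_
    gcongr
    exact Finset.le_sup (f := fun i => (k i).queries) (Finset.mem_univ i)

theorem bind_assoc {δ : Type} (A : QueryAlg n β) (B : β → QueryAlg n γ) (D : γ → QueryAlg n δ) :
    (A.bind B).bind D = A.bind fun b => (B b).bind D := by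
  induction A with
  | ret a => rfl
  | query x k ih => simp only [bind, ih]
  | uniform ι k ih => simp only [bind, ih]

end QueryAlg

theorem BuiltFromAESearch.bind {n : ℕ} {β γ : Type} {A : QueryAlg n β} {B : β → QueryAlg n γ}
    (hA : BuiltFromAESearch A) (hB : ∀ b, BuiltFromAESearch (B b)) :
    BuiltFromAESearch (A.bind B) := by
  induction hA with
  | ret a => exact hB a
  | uniform ι k _ ih => exact .uniform ι _ ih
  | search x S k _ ih =>
    rw [QueryAlg.bind_assoc]
    exact .search x S _ ih

/-! ### Uniform sampling and repeated independent attempts -/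

namespace QueryAlg

variable {n : ℕ} {α β : Type}

/-- A uniformly random element of `s`, or `a` if `s` is empty. -/
noncomputable def pick (s : Finset α) (a : α) : QueryAlg n α :=
  if h : s.Nonempty then
    haveI : Nonempty {b // b ∈ s} := h.to_subtype
    uniform {b // b ∈ s} fun b => ret b.1
  else ret a

theorem expect_pick (f : Cube n → Bool) {s : Finset α} (hs : s.Nonempty) (a : α) (g : α → ℝ) :
    (pick s a : QueryAlg n α).expect f g = (∑ b ∈ s, g b) / s.card := by
  rw [pick, dif_pos hs]
  simp only [expect, Fintype.card_coe]
  rw [← Finset.sum_coe_sort s g]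

theorem queries_pick (s : Finset α) (a : α) : (pick s a : QueryAlg n α).queries = 0 := by
  unfold pick
  split_ifs <;> simp [queries]

theorem builtFromAESearch_pick (s : Finset α) (a : α) :
    BuiltFromAESearch (pick s a : QueryAlg n α) := by
  unfold pick
  split_ifs with h
  · have : Nonempty {b // b ∈ s} := h.to_subtype
    exact .uniform _ _ fun b => .ret b.1
  · exact .ret a

/-- Run `A`, and run `B` if `A` gives no output. -/
def orElse (A B : QueryAlg n (Option β)) : QueryAlg n (Option β) :=
  A.bind fun o => match o with
    | some v => ret (some v)
    | none => B

/-- The probability that there is no output. -/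
noncomputable def failure (f : Cube n → Bool) (A : QueryAlg n (Option β)) : ℝ :=
  A.expect f fun o => if o.isSome then 0 else 1

theorem failure_nonneg (f : Cube n → Bool) (A : QueryAlg n (Option β)) : 0 ≤ A.failure f :=
  expect_nonneg fun o => by split_ifs <;> simp

theorem failure_orElse (f : Cube n → Bool) (A B : QueryAlg n (Option β)) :
    (A.orElse B).failure f = A.failure f * B.failure f := by
  rw [mul_comm, failure, orElse, expect_bind]
  refine Eq.trans ?_ (expect_const_mul f A (B.failure f) _)
  congr 1
  funext o
  cases o <;> simp [expect, failure]

/-- Run the algorithms `A a` for the elements `a` of `s` until one gives an output. -/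
noncomputable def tryAll (s : Finset α) (A : α → QueryAlg n (Option β)) : QueryAlg n (Option β) :=
  s.toList.foldr (fun a B => (A a).orElse B) (ret none)

theorem failure_tryAll (f : Cube n → Bool) (s : Finset α) (A : α → QueryAlg n (Option β)) :
    (tryAll s A).failure f = ∏ a ∈ s, (A a).failure f := by
  rw [← Finset.prod_map_toList, tryAll]
  induction s.toList with
  | nil => simp [failure, expect]
  | cons a l ih => simp [failure_orElse, ih]

theorem queries_tryAll_le (s : Finset α) (A : α → QueryAlg n (Option β)) :
    (tryAll s A).queries ≤ ∑ a ∈ s, (A a).queries := by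
  rw [← Finset.sum_map_toList, tryAll]
  induction s.toList with
  | nil => simp [queries]
  | cons a l ih =>
    simp only [List.foldr_cons, List.map_cons, List.sum_cons]
    refine queries_bind_le fun o => ?_
    cases o
    · exact ih
    · simp [queries]

theorem builtFromAESearch_tryAll {s : Finset α} {A : α → QueryAlg n (Option β)}
    (h : ∀ a, BuiltFromAESearch (A a)) : BuiltFromAESearch (tryAll s A) := by
  rw [tryAll]
  induction s.toList with
  | nil => exact .ret none
  | cons a l ih =>
    refine (h a).bind fun o => ?_
    cases o
    · exact ih
    · exact .ret _

theorem exists_mem_support_of_tryAll {f : Cube n → Bool} {s : Finset α}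
    {A : α → QueryAlg n (Option β)} {v : β} (h : some v ∈ ((tryAll s A).run f).support) :
    ∃ a, some v ∈ ((A a).run f).support := by
  rw [tryAll] at h
  generalize s.toList = l at h
  induction l with
  | nil => exact absurd (mem_support_run_ret.1 h) (by simp)
  | cons a l ih =>
    rw [List.foldr_cons, orElse, mem_support_run_bind] at h
    obtain ⟨o, ho, hv⟩ := h
    cases o with
    | none => exact ih hv
    | some w =>
      obtain rfl : v = w := by simpa using mem_support_run_ret.1 hv
      exact ⟨a, ho⟩

end QueryAlg

/-! ### Cost and soundness of adaptive edge search -/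

theorem queries_queryAll_le {n : ℕ} (L : ℕ) (xs : Fin L → Cube n) :
    (QueryAlg.queryAll L xs).queries ≤ L := by
  induction L with
  | zero => simp [QueryAlg.queryAll, QueryAlg.queries]
  | succ L ih =>
    have h : ∀ b, ((QueryAlg.queryAll L fun l => xs l.succ).bind fun bs =>
        (QueryAlg.ret (Fin.cons b bs) : QueryAlg n (Fin (L + 1) → Bool))).queries ≤ L := fun b =>
      (QueryAlg.queries_bind_le (m := 0) fun bs => le_of_eq rfl).trans (ih _)
    have h₀ := h false
    have h₁ := h true
    simp only [QueryAlg.queryAll, QueryAlg.queries]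
    omega

theorem queries_aeFinish_le {n L : ℕ} (x : Cube n) (b : Bool) (T : Fin L → Finset (Fin n))
    (bs : Fin L → Bool) : (aeFinish x b T bs).queries ≤ 1 := by
  unfold aeFinish
  dsimp only
  split_ifs <;> simp [QueryAlg.queries]

theorem queries_aeSearch_le {n : ℕ} (x : Cube n) (S : Finset (Fin n)) :
    (aeSearch x S).queries ≤ ⌈4 * Real.logb 2 n⌉₊ + 2 := by
  unfold aeSearch
  split_ifs with h
  · have key : ∀ (b : Bool) (T : Fin ⌈4 * Real.logb 2 n⌉₊ →
        {T : Finset (Fin n) // T ∈ S.powersetCard ((S.card - 1) / 2 + 1)}),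
        ((QueryAlg.queryAll _ fun l => flipSet x (T l).1).bind fun bs =>
          aeFinish x b (fun l => (T l).1) bs).queries ≤ ⌈4 * Real.logb 2 n⌉₊ + 1 := fun b T =>
      (QueryAlg.queries_bind_le fun bs => queries_aeFinish_le x b _ bs).trans
        (Nat.add_le_add_right (queries_queryAll_le _ _) 1)
    simp only [QueryAlg.queries]
    rw [add_comm 1]
    exact Nat.add_le_add_right (max_le (Finset.sup_le fun T _ => key false T)
      (Finset.sup_le fun T _ => key true T)) 1
  · simp [QueryAlg.queries]

/-- Adaptive edge search returns bi-chromatic edges only. -/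
theorem isEdge_of_mem_support_aeSearch {n : ℕ} {f : Cube n → Bool} {x : Cube n}
    {S : Finset (Fin n)} {i : Fin n} {κ : EdgeKind}
    (h : some (i, κ) ∈ ((aeSearch x S).run f).support) : IsEdge f κ i x := by
  unfold aeSearch at h
  split_ifs at h with hS
  · rw [QueryAlg.run, QueryAlg.mem_support_run_uniform] at h
    obtain ⟨T, h⟩ := h
    rw [QueryAlg.mem_support_run_bind] at h
    obtain ⟨bs, -, h⟩ := h
    unfold aeFinish at h
    dsimp only at h
    split_ifs at h with hC
    · rw [QueryAlg.run, QueryAlg.mem_support_run_ret] at h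
      split_ifs at h with hb
      obtain ⟨rfl, rfl⟩ := Prod.mk.inj (Option.some.inj h)
      exact ⟨hb.symm, rfl⟩
    · exact absurd (QueryAlg.mem_support_run_ret.1 h) (by simp)
  · exact absurd (QueryAlg.mem_support_run_ret.1 h) (by simp)

theorem builtFromAESearch_aeSearch_bind {n : ℕ} {β : Type} (x : Cube n) (S : Finset (Fin n))
    (g : Option (Fin n × EdgeKind) → β) :
    BuiltFromAESearch ((aeSearch x S).bind fun o => QueryAlg.ret (g o)) :=
  .search x S _ fun o => .ret (g o)

/-- The result of an adaptive edge search: the point and the answer. -/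
abbrev SearchResult (n : ℕ) : Type := Cube n × Option (Fin n × EdgeKind)

/-- Adaptive edge search from a uniformly random point. -/
noncomputable def probe {n : ℕ} (S : Finset (Fin n)) : QueryAlg n (SearchResult n) :=
  QueryAlg.uniform (Cube n) fun x => (aeSearch x S).bind fun o => QueryAlg.ret (x, o)

/-- Adaptive edge search in a random subset of `S` of size `2 ^ k`, from a random point. -/
noncomputable def subProbe {n : ℕ} (k : ℕ) (S : Finset (Fin n)) : QueryAlg n (SearchResult n) :=
  (QueryAlg.pick (S.powersetCard (2 ^ k)) ∅).bind probe

theorem queries_probe_le {n : ℕ} (S : Finset (Fin n)) :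
    (probe S).queries ≤ ⌈4 * Real.logb 2 n⌉₊ + 2 := by
  simp only [probe, QueryAlg.queries]
  exact Finset.sup_le fun x _ =>
    (QueryAlg.queries_bind_le (m := 0) fun o => le_of_eq rfl).trans (queries_aeSearch_le x S)

theorem queries_subProbe_le {n : ℕ} (k : ℕ) (S : Finset (Fin n)) :
    (subProbe k S).queries ≤ ⌈4 * Real.logb 2 n⌉₊ + 2 :=
  (QueryAlg.queries_bind_le queries_probe_le).trans (by rw [QueryAlg.queries_pick, zero_add])

theorem builtFromAESearch_probe {n : ℕ} (S : Finset (Fin n)) : BuiltFromAESearch (probe S) :=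
  .uniform _ _ fun x => builtFromAESearch_aeSearch_bind x S _

theorem builtFromAESearch_subProbe {n : ℕ} (k : ℕ) (S : Finset (Fin n)) :
    BuiltFromAESearch (subProbe k S) :=
  (QueryAlg.builtFromAESearch_pick _ _).bind builtFromAESearch_probe

theorem isEdge_of_mem_support_probe {n : ℕ} {f : Cube n → Bool} {S : Finset (Fin n)}
    {r : SearchResult n} (h : r ∈ ((probe S).run f).support) {i : Fin n} {κ : EdgeKind}
    (hr : r.2 = some (i, κ)) : IsEdge f κ i r.1 := by
  rw [probe, QueryAlg.mem_support_run_uniform] at h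
  obtain ⟨x, h⟩ := h
  rw [QueryAlg.mem_support_run_bind] at h
  obtain ⟨o, ho, h⟩ := h
  rw [QueryAlg.mem_support_run_ret] at h
  subst h
  obtain rfl : o = some (i, κ) := hr
  exact isEdge_of_mem_support_aeSearch ho

theorem isEdge_of_mem_support_subProbe {n : ℕ} {f : Cube n → Bool} {k : ℕ} {S : Finset (Fin n)}
    {r : SearchResult n} (h : r ∈ ((subProbe k S).run f).support) {i : Fin n} {κ : EdgeKind}
    (hr : r.2 = some (i, κ)) : IsEdge f κ i r.1 := by
  rw [subProbe, QueryAlg.mem_support_run_bind] at h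
  obtain ⟨T, -, h⟩ := h
  exact isEdge_of_mem_support_probe h hr

/-! ### Recording edges and matching them: one trial -/

/-- The kind of edges that is named by a Boolean. -/
def kindOf (b : Bool) : EdgeKind := if b then EdgeKind.monotone else EdgeKind.antiMonotone

/-- For each direction, a point found to have an edge of the wanted kind in that direction. -/
abbrev Record (n : ℕ) : Type := Fin n → Option (Cube n)

open Classical in
/-- Record the edge found by a search if it has the kind `b`. -/
noncomputable def Record.insert {n : ℕ} (b : Bool) (m : Record n) (r : SearchResult n) :
    Record n := fun i => if r.2 = some (i, kindOf b) then some r.1 else m i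

/-- Perform `t` searches and record the edges of kind `b`. -/
noncomputable def gather {n : ℕ} (b : Bool) (A : QueryAlg n (SearchResult n)) :
    ℕ → Record n → QueryAlg n (Record n)
  | 0, m => QueryAlg.ret m
  | t + 1, m => A.bind fun r => gather b A t (m.insert b r)

/-- Two points with edges of kind `b` and `!b`, arranged as a pair of edges. -/
def edgePairOf {n : ℕ} (b : Bool) (i : Fin n) (x y : Cube n) : EdgePair n :=
  if b then ⟨i, x, y⟩ else ⟨i, y, x⟩

theorem isViolation_edgePairOf {n : ℕ} {f : Cube n → Bool} {b : Bool} {i : Fin n} {x y : Cube n}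
    (hx : IsEdge f (kindOf b) i x) (hy : IsEdge f (kindOf !b) i y) :
    (edgePairOf b i x y).IsViolation f := by
  cases b
  · exact ⟨hy, hx⟩
  · exact ⟨hx, hy⟩

open Classical in
/-- Match the result of a search with the recorded edges of kind `b`. -/
noncomputable def Record.matchResult {n : ℕ} (b : Bool) (m : Record n) (r : SearchResult n) :
    Option (EdgePair n) :=
  r.2.bind fun e =>
    if e.2 = kindOf !b then (m e.1).map fun x => edgePairOf b e.1 x r.1 else none

/-- Search for an edge of kind `!b` in a recorded direction, at most `t` times. -/
noncomputable def hunt {n : ℕ} (b : Bool) (A : QueryAlg n (SearchResult n)) (t : ℕ)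
    (m : Record n) : QueryAlg n (Option (EdgePair n)) :=
  QueryAlg.tryAll (Finset.range t) fun _ => A.bind fun r => QueryAlg.ret (m.matchResult b r)

theorem queries_gather_le {n : ℕ} {b : Bool} {A : QueryAlg n (SearchResult n)} (t : ℕ)
    (m : Record n) : (gather b A t m).queries ≤ t * A.queries := by
  induction t generalizing m with
  | zero => simp [gather, QueryAlg.queries]
  | succ t ih =>
    rw [gather, Nat.succ_mul, add_comm]
    exact QueryAlg.queries_bind_le fun _ => ih _

theorem queries_hunt_le {n : ℕ} {b : Bool} {A : QueryAlg n (SearchResult n)} (t : ℕ)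
    (m : Record n) : (hunt b A t m).queries ≤ t * A.queries := by
  refine (QueryAlg.queries_tryAll_le _ _).trans ((Finset.sum_le_card_nsmul _ _ A.queries
    fun a _ => QueryAlg.queries_bind_le (m := 0) fun _ => le_of_eq rfl).trans ?_)
  simp

theorem builtFromAESearch_gather {n : ℕ} {b : Bool} {A : QueryAlg n (SearchResult n)}
    (hA : BuiltFromAESearch A) (t : ℕ) (m : Record n) : BuiltFromAESearch (gather b A t m) := by
  induction t generalizing m with
  | zero => exact .ret m
  | succ t ih => exact hA.bind fun _ => ih _

theorem builtFromAESearch_hunt {n : ℕ} {b : Bool} {A : QueryAlg n (SearchResult n)}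
    (hA : BuiltFromAESearch A) (t : ℕ) (m : Record n) : BuiltFromAESearch (hunt b A t m) :=
  QueryAlg.builtFromAESearch_tryAll fun _ => hA.bind fun _ => .ret _

theorem isEdge_of_mem_support_gather {n : ℕ} {f : Cube n → Bool} {b : Bool}
    {A : QueryAlg n (SearchResult n)}
    (hA : ∀ r ∈ (A.run f).support, ∀ i κ, r.2 = some (i, κ) → IsEdge f κ i r.1) {t : ℕ}
    {m : Record n} (hm : ∀ i x, m i = some x → IsEdge f (kindOf b) i x) {m' : Record n}
    (h : m' ∈ ((gather b A t m).run f).support) {i : Fin n} {x : Cube n} (hx : m' i = some x) :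
    IsEdge f (kindOf b) i x := by
  induction t generalizing m with
  | zero =>
    rw [gather, QueryAlg.mem_support_run_ret] at h
    exact hm i x (h ▸ hx)
  | succ t ih =>
    rw [gather, QueryAlg.mem_support_run_bind] at h
    obtain ⟨r, hr, h⟩ := h
    refine ih (fun i x hx => ?_) h
    unfold Record.insert at hx
    split_ifs at hx with hi
    · exact Option.some.inj hx ▸ hA r hr _ _ hi
    · exact hm i x hx

theorem isViolation_of_mem_support_hunt {n : ℕ} {f : Cube n → Bool} {b : Bool}
    {A : QueryAlg n (SearchResult n)}
    (hA : ∀ r ∈ (A.run f).support, ∀ i κ, r.2 = some (i, κ) → IsEdge f κ i r.1) {t : ℕ}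
    {m : Record n} (hm : ∀ i x, m i = some x → IsEdge f (kindOf b) i x) {v : EdgePair n}
    (h : some v ∈ ((hunt b A t m).run f).support) : v.IsViolation f := by
  obtain ⟨-, h⟩ := QueryAlg.exists_mem_support_of_tryAll h
  rw [QueryAlg.mem_support_run_bind] at h
  obtain ⟨r, hr, h⟩ := h
  rw [QueryAlg.mem_support_run_ret, Record.matchResult, eq_comm, Option.bind_eq_some_iff] at h
  obtain ⟨⟨i, κ⟩, hi, h⟩ := h
  split_ifs at h with hκ
  obtain ⟨x, hx, rfl⟩ := Option.map_eq_some_iff.1 h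
  exact isViolation_edgePairOf (hm i x hx) (hκ ▸ hA r hr i κ hi)

/-- One trial: choose a random set of size `2 ^ j`, record the edges of kind `b` found by `M`
searches in it, and match them with the edges of kind `!b` found by `M` searches in random subsets
of size `2 ^ k`. -/
noncomputable def trial {n : ℕ} (b : Bool) (j k M : ℕ) : QueryAlg n (Option (EdgePair n)) :=
  (QueryAlg.pick ((Finset.univ : Finset (Fin n)).powersetCard (2 ^ j)) ∅).bind fun S =>
    (gather b (probe S) M fun _ => none).bind (hunt b (subProbe k S) M)

theorem queries_trial_le {n : ℕ} (b : Bool) (j k M : ℕ) :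
    (trial b j k M : QueryAlg n _).queries ≤ 2 * M * (⌈4 * Real.logb 2 n⌉₊ + 2) := by
  refine (QueryAlg.queries_bind_le fun S => (QueryAlg.queries_bind_le fun m =>
    (queries_hunt_le M m).trans (Nat.mul_le_mul_left M (queries_subProbe_le k S))).trans
    (Nat.add_le_add_right ((queries_gather_le M _).trans
      (Nat.mul_le_mul_left M (queries_probe_le S))) _)).trans ?_
  rw [QueryAlg.queries_pick]
  apply le_of_eq
  ring

theorem builtFromAESearch_trial {n : ℕ} (b : Bool) (j k M : ℕ) :
    BuiltFromAESearch (trial b j k M : QueryAlg n _) :=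
  (QueryAlg.builtFromAESearch_pick _ _).bind fun S =>
    (builtFromAESearch_gather (builtFromAESearch_probe S) _ _).bind fun m =>
      builtFromAESearch_hunt (builtFromAESearch_subProbe k S) _ m

theorem isViolation_of_mem_support_trial {n : ℕ} {f : Cube n → Bool} {b : Bool} {j k M : ℕ}
    {v : EdgePair n} (h : some v ∈ ((trial b j k M).run f).support) : v.IsViolation f := by
  rw [trial, QueryAlg.mem_support_run_bind] at h
  obtain ⟨S, -, h⟩ := h
  rw [QueryAlg.mem_support_run_bind] at h
  obtain ⟨m, hm, h⟩ := h
  exact isViolation_of_mem_support_hunt (fun r hr i κ => isEdge_of_mem_support_subProbe hr)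
    (fun i x => isEdge_of_mem_support_gather (fun r hr i κ => isEdge_of_mem_support_probe hr)
      (fun i x hx => by simp at hx) hm) h

/-! ### Averages and a product inequality -/

/-- The average of `φ` over `s`. -/
noncomputable def average {α : Type*} (s : Finset α) (φ : α → ℝ) : ℝ := (∑ a ∈ s, φ a) / s.card

theorem average_mono {α : Type*} {s : Finset α} {φ ψ : α → ℝ} (h : ∀ a ∈ s, φ a ≤ ψ a) :
    average s φ ≤ average s ψ :=
  div_le_div_of_nonneg_right (Finset.sum_le_sum h) (Nat.cast_nonneg _)

theorem average_nonneg {α : Type*} {s : Finset α} {φ : α → ℝ} (h : ∀ a ∈ s, 0 ≤ φ a) :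
    0 ≤ average s φ :=
  div_nonneg (Finset.sum_nonneg h) (Nat.cast_nonneg _)

theorem average_const {α : Type*} {s : Finset α} (hs : s.Nonempty) (c : ℝ) :
    average s (fun _ => c) = c := by
  have : (s.card : ℝ) ≠ 0 := by exact_mod_cast hs.card_pos.ne'
  rw [average, Finset.sum_const, nsmul_eq_mul, mul_div_cancel_left₀ _ this]

theorem average_const_mul {α : Type*} (s : Finset α) (c : ℝ) (φ : α → ℝ) :
    average s (fun a => c * φ a) = c * average s φ := by
  rw [average, ← Finset.mul_sum, mul_div_assoc, average]

theorem average_sub {α : Type*} (s : Finset α) (φ ψ : α → ℝ) :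
    average s (fun a => φ a - ψ a) = average s φ - average s ψ := by
  rw [average, Finset.sum_sub_distrib, sub_div, average, average]

theorem average_add {α : Type*} (s : Finset α) (φ ψ : α → ℝ) :
    average s (fun a => φ a + ψ a) = average s φ + average s ψ := by
  rw [average, Finset.sum_add_distrib, add_div, average, average]

theorem average_sum {α ι : Type*} (s : Finset α) (t : Finset ι) (φ : ι → α → ℝ) :
    average s (fun a => ∑ i ∈ t, φ i a) = ∑ i ∈ t, average s (φ i) := by
  simp only [average]
  rw [Finset.sum_comm, Finset.sum_div]

/-- The Weierstrass product inequality. -/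
theorem one_sub_sum_le_prod_one_sub {ι : Type*} (s : Finset ι) {z : ι → ℝ}
    (h₀ : ∀ i ∈ s, 0 ≤ z i) (h₁ : ∀ i ∈ s, z i ≤ 1) :
    1 - ∑ i ∈ s, z i ≤ ∏ i ∈ s, (1 - z i) := by
  classical
  induction s using Finset.induction_on with
  | empty => simp
  | insert i s hi ih =>
    rw [Finset.sum_insert hi, Finset.prod_insert hi]
    have ih := ih (fun j hj => h₀ j (Finset.mem_insert_of_mem hj))
      fun j hj => h₁ j (Finset.mem_insert_of_mem hj)
    have hs : 0 ≤ ∑ j ∈ s, z j :=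
      Finset.sum_nonneg fun j hj => h₀ j (Finset.mem_insert_of_mem hj)
    have hi₀ := h₀ i (Finset.mem_insert_self i s)
    have hi₁ := h₁ i (Finset.mem_insert_self i s)
    nlinarith [mul_le_mul_of_nonneg_left ih (sub_nonneg.2 hi₁), mul_nonneg hi₀ hs]

/-! ### Collision probability of a trial -/

open Classical in
/-- The probability that the search `A` finds an edge of kind `b` in direction `i`. -/
noncomputable def hitProb {n : ℕ} (f : Cube n → Bool) (b : Bool) (A : QueryAlg n (SearchResult n))
    (i : Fin n) : ℝ :=
  A.expect f fun r => if r.2 = some (i, kindOf b) then 1 else 0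

theorem hitProb_nonneg {n : ℕ} (f : Cube n → Bool) (b : Bool) (A : QueryAlg n (SearchResult n))
    (i : Fin n) : 0 ≤ hitProb f b A i :=
  QueryAlg.expect_nonneg fun r => by split_ifs <;> simp

/-- A search returns at most one direction, so these events are disjoint. -/
theorem sum_hitProb_le_one {n : ℕ} (f : Cube n → Bool) (b : Bool)
    (A : QueryAlg n (SearchResult n)) (s : Finset (Fin n)) : ∑ i ∈ s, hitProb f b A i ≤ 1 := by
  classical
  unfold hitProb
  rw [← QueryAlg.expect_sum]
  refine (QueryAlg.expect_mono (g' := fun _ => 1) fun r => ?_).trans_eq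
    (QueryAlg.expect_const f A 1)
  by_cases h : ∃ i, r.2 = some (i, kindOf b)
  · obtain ⟨i, hi⟩ := h
    simp only [hi, Option.some.injEq, Prod.mk.injEq, and_true, Finset.sum_ite_eq]
    split_ifs <;> norm_num
  · rw [Finset.sum_eq_zero fun i _ => if_neg fun hi => h ⟨i, hi⟩]
    exact zero_le_one

theorem hitProb_le_one {n : ℕ} (f : Cube n → Bool) (b : Bool) (A : QueryAlg n (SearchResult n))
    (i : Fin n) : hitProb f b A i ≤ 1 := by
  simpa using sum_hitProb_le_one f b A {i}

/-- For a fixed record the attempts are independent, and each succeeds with the total probability of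
the recorded directions, since hits in different directions are disjoint. -/
theorem failure_hunt {n : ℕ} (f : Cube n → Bool) (b : Bool) (A : QueryAlg n (SearchResult n))
    (t : ℕ) (m : Record n) :
    (hunt b A t m).failure f =
      (1 - ∑ i, if (m i).isSome then hitProb f (!b) A i else 0) ^ t := by
  classical
  rw [hunt, QueryAlg.failure_tryAll, Finset.prod_const, Finset.card_range]
  congr 1
  rw [QueryAlg.failure, QueryAlg.expect_bind]
  have h : ∀ r : SearchResult n,
      (QueryAlg.ret (m.matchResult b r) : QueryAlg n _).expect f (fun o => if o.isSome then 0 else 1) =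
        1 - ∑ i, (if (m i).isSome then 1 else 0) *
          (if r.2 = some (i, kindOf !b) then (1 : ℝ) else 0) := by
    rintro ⟨x, o⟩
    rw [QueryAlg.expect, Record.matchResult]
    rcases o with _ | ⟨i, κ⟩
    · simp
    · by_cases hκ : κ = kindOf !b
      · cases hm : m i <;> simp [hκ, hm]
      · simp [hκ]
  simp only [h]
  rw [QueryAlg.expect_sub, QueryAlg.expect_const, QueryAlg.expect_sum]
  congr 1
  refine Finset.sum_congr rfl fun i _ => ?_
  rw [QueryAlg.expect_const_mul, ite_mul, one_mul, zero_mul, hitProb]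

/-- The bound is the value that would hold if the directions were recorded independently. In fact
one search records at most one direction; this dependence only helps, because the Weierstrass
inequality compares the single-step expectation with the independent product. -/
theorem expect_gather_le {n : ℕ} (f : Cube n → Bool) (b : Bool) (A : QueryAlg n (SearchResult n))
    {e : Fin n → ℝ} (he₀ : ∀ i, 0 < e i) (he₁ : ∀ i, e i ≤ 1) (t : ℕ) (m : Record n) :
    (gather b A t m).expect f (fun m => ∏ i, if (m i).isSome then e i else 1) ≤
      ∏ i, if (m i).isSome then e i else e i + (1 - e i) * (1 - hitProb f b A i) ^ t := by
  classical
  induction t generalizing m with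
  | zero => simp [gather, QueryAlg.expect]
  | succ t ih =>
    set p := hitProb f b A with hp
    have hp₀ : ∀ i, 0 ≤ p i := hitProb_nonneg f b A
    have hp₁ : ∀ i, p i ≤ 1 := hitProb_le_one f b A
    -- `v i` is the factor of direction `i` in the bound for the remaining `t` searches; recording
    -- `i` replaces it by `e i`.
    set v : Fin n → ℝ := fun i =>
      if (m i).isSome then e i else e i + (1 - e i) * (1 - p i) ^ t with hv
    have hev : ∀ i, e i ≤ v i := fun i => by
      have h := mul_nonneg (sub_nonneg.2 (he₁ i)) (pow_nonneg (sub_nonneg.2 (hp₁ i)) t)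
      simp only [hv]
      split_ifs <;> linarith
    have hv₀ : ∀ i, 0 < v i := fun i => (he₀ i).trans_le (hev i)
    have hstep : ∀ r : SearchResult n,
        (∏ i, if (m.insert b r i).isSome then e i else e i + (1 - e i) * (1 - p i) ^ t) =
          (∏ i, v i) * (1 - ∑ i, (1 - e i / v i) *
            (if r.2 = some (i, kindOf b) then (1 : ℝ) else 0)) := by
      intro r
      by_cases h : ∃ i, r.2 = some (i, kindOf b)
      · obtain ⟨i, hi⟩ := h
        have h₁ : ∀ k, (if (m.insert b r k).isSome then e k
            else e k + (1 - e k) * (1 - p k) ^ t) = Function.update v i (e i) k := by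
          intro k
          rcases eq_or_ne k i with rfl | hk
          · simp [Record.insert, hi]
          · simp [Record.insert, hi, hk, hk.symm, hv]
        simp only [h₁]
        rw [Finset.prod_update_of_mem (Finset.mem_univ i),
          ← Finset.mul_prod_erase Finset.univ v (Finset.mem_univ i), Finset.sdiff_singleton_eq_erase]
        simp only [hi, Option.some.injEq, Prod.mk.injEq, and_true, mul_ite, mul_one, mul_zero,
          Finset.sum_ite_eq, Finset.mem_univ, if_true]
        have := (hv₀ i).ne'
        field_simp
        ring
      · have h₁ : ∀ i, r.2 ≠ some (i, kindOf b) := fun i hi => h ⟨i, hi⟩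
        simp [Record.insert, h₁, hv]
    rw [gather, QueryAlg.expect_bind]
    refine (QueryAlg.expect_mono fun r => (ih _).trans_eq (hstep r)).trans ?_
    rw [QueryAlg.expect_const_mul, QueryAlg.expect_sub, QueryAlg.expect_const,
      QueryAlg.expect_sum]
    simp only [QueryAlg.expect_const_mul]
    have hz : ∀ i, 0 ≤ 1 - e i / v i := fun i => sub_nonneg.2 ((div_le_one (hv₀ i)).2 (hev i))
    have hz' : ∀ i, 1 - e i / v i ≤ 1 := fun i =>
      sub_le_self _ (div_nonneg (he₀ i).le (hv₀ i).le)
    -- The sum over disjoint outcomes becomes a product, and each factor then advances separately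
    -- from exponent `t` to `t + 1`.
    refine (mul_le_mul_of_nonneg_left (one_sub_sum_le_prod_one_sub Finset.univ
      (z := fun i => (1 - e i / v i) * p i) (fun i _ => mul_nonneg (hz i) (hp₀ i))
      fun i _ => mul_le_one₀ (hz' i) (hp₀ i) (hp₁ i))
      (Finset.prod_nonneg fun i _ => (hv₀ i).le)).trans_eq ?_
    rw [← Finset.prod_mul_distrib]
    refine Finset.prod_congr rfl fun i _ => ?_
    have h₁ : v i * (1 - (1 - e i / v i) * p i) = v i - (v i - e i) * p i := by
      have := (hv₀ i).ne'
      field_simp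
    rw [h₁]
    simp only [hv]
    split_ifs
    · ring
    · ring

/-- With `s = min t 1`, the inequality `exp (-s) ≤ 1 / (1 + s)` gives `1 - exp (-s) ≥ s / (1 + s) ≥
s / 2`. -/
theorem min_one_div_two_le_one_sub_exp_neg {t : ℝ} (ht : 0 ≤ t) :
    min t 1 / 2 ≤ 1 - Real.exp (-t) := by
  have h₁ : Real.exp (-t) ≤ Real.exp (-min t 1) :=
    Real.exp_le_exp.2 (neg_le_neg (min_le_left t 1))
  have hs₀ : 0 ≤ min t 1 := le_min ht zero_le_one
  have hs₁ : min t 1 ≤ 1 := min_le_right t 1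
  set s := min t 1
  have h₂ : Real.exp (-s) * (1 + s) ≤ 1 := by
    rw [Real.exp_neg, inv_mul_le_iff₀ (Real.exp_pos s), mul_one, add_comm]
    exact Real.add_one_le_exp s
  nlinarith [Real.exp_pos (-s)]

/-- The probability that `M` searches with success probabilities `p` and `M` searches with success
probabilities `q` have no common result is at most `4 / 5` when `M` is large enough. -/
theorem prod_le_of_card_le {ι : Type*} [Fintype ι] {p q : ι → ℝ} (hp₀ : ∀ i, 0 ≤ p i)
    (hp₁ : ∀ i, p i ≤ 1) (hq₀ : ∀ i, 0 ≤ q i) {M : ℕ} {s : Finset ι} (hs : s.Nonempty)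
    (h : (s.card : ℝ) ≤ (M * ∑ i ∈ s, min (p i) (q i)) ^ 2) :
    ∏ i, (Real.exp (-(M * q i)) + (1 - Real.exp (-(M * q i))) * (1 - p i) ^ M) ≤ 4 / 5 := by
  set r : ι → ℝ := fun i => min (p i) (q i) with hr
  have hr₀ : ∀ i, 0 ≤ r i := fun i => le_min (hp₀ i) (hq₀ i)
  -- `y i` bounds from below both the chance that direction `i` is recorded and `1 - exp (-(M * q
  -- i))`; hence each factor is at most `1 - y i ^ 2`.
  set y : ι → ℝ := fun i => min (M * r i) 1 / 2 with hy
  have hy₀ : ∀ i, 0 ≤ y i := fun i => by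
    have := hr₀ i
    simp only [hy]
    positivity
  have hfac : ∀ i, Real.exp (-(M * q i)) + (1 - Real.exp (-(M * q i))) * (1 - p i) ^ M ≤
      Real.exp (-y i ^ 2) := by
    intro i
    have hM : (0 : ℝ) ≤ M := Nat.cast_nonneg M
    have h₁ : y i ≤ 1 - Real.exp (-(M * q i)) :=
      (min_one_div_two_le_one_sub_exp_neg (mul_nonneg hM (hr₀ i))).trans (by
        gcongr
        exact min_le_right _ _)
    have h₂ : (1 - p i) ^ M ≤ 1 - y i := by
      have h₃ : y i ≤ 1 - Real.exp (-(M * p i)) :=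
        (min_one_div_two_le_one_sub_exp_neg (mul_nonneg hM (hr₀ i))).trans (by
          gcongr
          exact min_le_left _ _)
      have h₄ : (1 - p i) ^ M ≤ Real.exp (-(M * p i)) := by
        rw [← mul_neg, Real.exp_nat_mul]
        exact pow_le_pow_left₀ (sub_nonneg.2 (hp₁ i)) (Real.one_sub_le_exp_neg (p i)) M
      linarith
    have h₅ := Real.one_sub_le_exp_neg (y i ^ 2)
    nlinarith [hy₀ i, mul_le_mul_of_nonneg_left h₂ ((hy₀ i).trans h₁),
      mul_le_mul_of_nonneg_right h₁ (hy₀ i)]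
  -- Either one direction alone has `y i = 1/2`, or no truncation occurs and Cauchy-Schwarz on `s`
  -- applies.
  have hsum : 1 / 4 ≤ ∑ i, y i ^ 2 := by
    by_cases hbig : ∃ i, 1 ≤ M * r i
    · obtain ⟨i, hi⟩ := hbig
      have h₁ := Finset.single_le_sum (f := fun i => y i ^ 2) (fun i _ => sq_nonneg (y i))
        (Finset.mem_univ i)
      have h₂ : y i = 1 / 2 := by simp only [hy, min_eq_right hi]
      simp only [h₂] at h₁
      linarith
    · push Not at hbig
      have h₁ : ∀ i, y i = M * r i / 2 := fun i => by simp only [hy, min_eq_left (hbig i).le]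
      have h₂ : ∑ i ∈ s, y i ^ 2 ≤ ∑ i, y i ^ 2 :=
        Finset.sum_le_univ_sum_of_nonneg fun i => sq_nonneg (y i)
      have h₃ := sq_sum_le_card_mul_sum_sq (s := s) (f := y)
      have h₄ : ∑ i ∈ s, y i = (M * ∑ i ∈ s, r i) / 2 := by
        simp only [h₁, Finset.mul_sum, Finset.sum_div]
      have hc : (0 : ℝ) < s.card := by exact_mod_cast hs.card_pos
      rw [h₄, div_pow] at h₃
      have h₅ : (s.card : ℝ) * (1 / 4) ≤ s.card * ∑ i ∈ s, y i ^ 2 := by linarith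
      exact (le_of_mul_le_mul_left h₅ hc).trans h₂
  have hnn : ∀ i, 0 ≤ Real.exp (-(M * q i)) + (1 - Real.exp (-(M * q i))) * (1 - p i) ^ M := by
    intro i
    have h₁ : Real.exp (-(M * q i)) ≤ 1 :=
      Real.exp_le_one_iff.2 (neg_nonpos.2 (mul_nonneg (Nat.cast_nonneg M) (hq₀ i)))
    exact add_nonneg (Real.exp_pos _).le
      (mul_nonneg (sub_nonneg.2 h₁) (pow_nonneg (sub_nonneg.2 (hp₁ i)) M))
  refine (Finset.prod_le_prod (fun i _ => hnn i) fun i _ => hfac i).trans ?_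
  rw [← Real.exp_sum, Finset.sum_neg_distrib]
  refine (Real.exp_le_exp.2 (neg_le_neg hsum)).trans ?_
  rw [Real.exp_neg, inv_le_comm₀ (Real.exp_pos _) (by norm_num)]
  linarith [Real.add_one_le_exp (1 / 4 : ℝ)]

/-- The weight of a set `S` at the scale `k`: the probabilities that a search in `S` finds an edge
of kind `b`, and a search in a random subset an edge of kind `!b`, combined over the directions. -/
noncomputable def weight {n : ℕ} (f : Cube n → Bool) (b : Bool) (k : ℕ) (S : Finset (Fin n)) : ℝ :=
  ∑ i ∈ S, min (hitProb f b (probe S) i) (hitProb f (!b) (subProbe k S) i)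

theorem weight_le_one {n : ℕ} (f : Cube n → Bool) (b : Bool) (k : ℕ) (S : Finset (Fin n)) :
    weight f b k S ≤ 1 :=
  (Finset.sum_le_sum fun _ _ => min_le_left _ _).trans (sum_hitProb_le_one f b (probe S) S)

/-- Given the record, the hunt fails with probability at most `exp (-(M * Q))`, where `Q` sums `q`
over recorded directions. This is a product over those directions, the form `expect_gather_le`
handles with `e i = exp (-(M * q i))`. -/
theorem failure_gather_hunt_le {n : ℕ} (f : Cube n → Bool) (b : Bool)
    (A B : QueryAlg n (SearchResult n)) (M : ℕ) :
    ((gather b A M fun _ => none).bind (hunt b B M)).failure f ≤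
      ∏ i, (Real.exp (-(M * hitProb f (!b) B i)) +
        (1 - Real.exp (-(M * hitProb f (!b) B i))) * (1 - hitProb f b A i) ^ M) := by
  set q := hitProb f (!b) B with hq
  have hq₀ : ∀ i, 0 ≤ q i := hitProb_nonneg _ _ _
  rw [QueryAlg.failure, QueryAlg.expect_bind]
  refine (QueryAlg.expect_mono (g' := fun m => ∏ i,
    if (m i).isSome then Real.exp (-(M * q i)) else 1) fun m => ?_).trans
    ((expect_gather_le f b A (fun i => Real.exp_pos _) (fun i => Real.exp_le_one_iff.2
      (neg_nonpos.2 (mul_nonneg (Nat.cast_nonneg M) (hq₀ i)))) M _).trans_eq ?_)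
  · have h := failure_hunt f b B M m
    rw [QueryAlg.failure] at h
    rw [h]
    have h₁ : ∑ i, (if (m i).isSome then q i else 0) ≤ 1 := by
      rw [← Finset.sum_filter]
      exact sum_hitProb_le_one f (!b) B _
    refine (pow_le_pow_left₀ (sub_nonneg.2 h₁) (Real.one_sub_le_exp_neg _) M).trans_eq ?_
    rw [← Real.exp_nat_mul, mul_neg, Finset.mul_sum, ← Finset.sum_neg_distrib, Real.exp_sum]
    refine Finset.prod_congr rfl fun i _ => ?_
    split_ifs <;> simp
  · simp

open Classical in
/-- A trial succeeds with constant probability when the random set has a large weight. -/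
theorem failure_trial_le {n : ℕ} (f : Cube n → Bool) (b : Bool) {j k M : ℕ} {w : ℝ}
    (hj : 2 ^ j ≤ n) (hM : (2 ^ j : ℝ) ≤ (M * w) ^ 2) (hw : 0 ≤ w) :
    (trial b j k M).failure f ≤ 1 - (1 / 5) *
      average ((Finset.univ : Finset (Fin n)).powersetCard (2 ^ j))
        fun S => if w ≤ weight f b k S then 1 else 0 := by
  set P := (Finset.univ : Finset (Fin n)).powersetCard (2 ^ j) with hP
  have hne : P.Nonempty := Finset.powersetCard_nonempty.2 (by simpa using hj)
  have hc : (0 : ℝ) < P.card := by exact_mod_cast hne.card_pos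
  rw [trial, QueryAlg.failure, QueryAlg.expect_bind, QueryAlg.expect_pick f hne]
  have key : ∀ S ∈ P, ((gather b (probe S) M fun _ => none).bind
      (hunt b (subProbe k S) M)).failure f ≤
        1 - (1 / 5) * (if w ≤ weight f b k S then 1 else 0) := by
    intro S hS
    have hcard : S.card = 2 ^ j := (Finset.mem_powersetCard.1 hS).2
    have hS' : S.Nonempty := Finset.card_pos.1 (hcard ▸ by positivity)
    split_ifs with h
    · refine (failure_gather_hunt_le f b _ _ M).trans ((prod_le_of_card_le (hitProb_nonneg _ _ _)
        (hitProb_le_one _ _ _) (hitProb_nonneg _ _ _) hS' ?_).trans (by norm_num))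
      rw [hcard]
      push_cast
      refine hM.trans ?_
      have : w ≤ ∑ i ∈ S, min (hitProb f b (probe S) i) (hitProb f (!b) (subProbe k S) i) := h
      gcongr
    · rw [mul_zero, sub_zero]
      exact (QueryAlg.expect_mono (g' := fun _ => 1) fun o => by split_ifs <;> norm_num).trans_eq
        (QueryAlg.expect_const f _ 1)
  refine (average_mono key).trans_eq ?_
  rw [average, average, Finset.sum_sub_distrib, ← Finset.mul_sum, sub_div, mul_div_assoc]
  simp [hc.ne']

/-! ### Uniformly random subsets of fixed size -/

/-- A random `(c + 1)`-subset of `U` contains `i` with probability `(c + 1) / U.card`, and given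
this its remainder is a uniform `c`-subset of `U.erase i`. The sets avoiding `i` are dropped, as `φ`
is nonnegative. -/
theorem average_insert_le {α : Type*} [DecidableEq α] {U : Finset α} {i : α} (hi : i ∈ U) {c : ℕ}
    (hc : c + 1 ≤ U.card) {φ : Finset α → ℝ} (hφ : ∀ S, 0 ≤ φ S) :
    ((c + 1 : ℕ) : ℝ) / U.card * average ((U.erase i).powersetCard c) (fun S => φ (insert i S)) ≤
      average (U.powersetCard (c + 1)) φ := by
  have hU : U.card - 1 + 1 = U.card := by omega
  have hcount := Nat.add_one_mul_choose_eq (U.card - 1) c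
  rw [hU] at hcount
  have h₁ : (0 : ℝ) < (U.card - 1).choose c := by
    exact_mod_cast Nat.choose_pos (by omega)
  have h₂ : (0 : ℝ) < U.card.choose (c + 1) := by exact_mod_cast Nat.choose_pos hc
  have h₃ : (0 : ℝ) < U.card := by exact_mod_cast Finset.card_pos.2 ⟨i, hi⟩
  have hcount' : (U.card : ℝ) * (U.card - 1).choose c = U.card.choose (c + 1) * (c + 1 : ℕ) := by
    exact_mod_cast hcount
  have hsum : ∑ S ∈ (U.erase i).powersetCard c, φ (insert i S) ≤
      ∑ S ∈ U.powersetCard (c + 1), φ S := by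
    have hinj : Set.InjOn (insert i) ((U.erase i).powersetCard c : Set (Finset α)) := by
      intro S hS T hT h
      have hiS : i ∉ S := fun hm =>
        Finset.notMem_erase i U ((Finset.mem_powersetCard.1 (Finset.mem_coe.1 hS)).1 hm)
      have hiT : i ∉ T := fun hm =>
        Finset.notMem_erase i U ((Finset.mem_powersetCard.1 (Finset.mem_coe.1 hT)).1 hm)
      rw [← Finset.erase_insert hiS, ← Finset.erase_insert hiT, h]
    rw [← Finset.sum_image (f := φ) hinj]
    refine Finset.sum_le_sum_of_subset_of_nonneg (fun S hS => ?_) fun S _ _ => hφ S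
    obtain ⟨T, hT, rfl⟩ := Finset.mem_image.1 hS
    rw [Finset.mem_powersetCard] at hT ⊢
    refine ⟨Finset.insert_subset hi (hT.1.trans (Finset.erase_subset i U)), ?_⟩
    rw [Finset.card_insert_of_notMem fun hm => Finset.notMem_erase i U (hT.1 hm), hT.2]
  rw [average, average, Finset.card_powersetCard, Finset.card_powersetCard,
    Finset.card_erase_of_mem hi]
  have h₄ : ((c + 1 : ℕ) : ℝ) / U.card = (U.card - 1).choose c / U.card.choose (c + 1) := by
    rw [div_eq_div_iff h₃.ne' h₂.ne']
    linarith
  rw [h₄, div_mul_div_comm, mul_comm, mul_div_mul_right _ _ h₁.ne']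
  gcongr

theorem card_filter_subset_powersetCard {α : Type*} [DecidableEq α] {U T : Finset α} (hT : T ⊆ U)
    {b : ℕ} (hb : T.card ≤ b) :
    ((U.powersetCard b).filter fun S => T ⊆ S).card = (U.card - T.card).choose (b - T.card) := by
  rw [← Finset.card_sdiff_of_subset hT, ← Finset.card_powersetCard]
  refine Finset.card_nbij' (· \ T) (· ∪ T) ?_ ?_ ?_ ?_
  · intro S hS
    simp only [Finset.coe_filter, Finset.mem_powersetCard, Set.mem_ofPred_eq] at hS
    simp only [Finset.mem_coe, Finset.mem_powersetCard]
    exact ⟨Finset.sdiff_subset_sdiff hS.1.1 subset_rfl, by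
      rw [Finset.card_sdiff_of_subset hS.2, hS.1.2]⟩
  · intro S hS
    simp only [Finset.mem_coe, Finset.mem_powersetCard] at hS
    have hd : Disjoint S T := (Finset.subset_sdiff.1 hS.1).2
    simp only [Finset.coe_filter, Finset.mem_powersetCard, Set.mem_ofPred_eq]
    refine ⟨⟨Finset.union_subset (hS.1.trans Finset.sdiff_subset) hT, ?_⟩,
      Finset.subset_union_right⟩
    rw [Finset.card_union_of_disjoint hd, hS.2]
    omega
  · intro S hS
    simp only [Finset.coe_filter, Finset.mem_powersetCard, Set.mem_ofPred_eq] at hS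
    exact Finset.sdiff_union_of_subset hS.2
  · intro S hS
    simp only [Finset.mem_coe, Finset.mem_powersetCard] at hS
    exact Finset.union_sdiff_cancel_right (Finset.subset_sdiff.1 hS.1).2

/-- A random subset of a random subset is a random subset. -/
theorem average_average_powersetCard {α : Type*} [DecidableEq α] {U : Finset α} {a b : ℕ}
    (hab : a ≤ b) (hb : b ≤ U.card) (φ : Finset α → ℝ) :
    average (U.powersetCard b) (fun S => average (S.powersetCard a) φ) =
      average (U.powersetCard a) φ := by
  have h₁ : ∑ S ∈ U.powersetCard b, ∑ T ∈ S.powersetCard a, φ T =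
      (U.card - a).choose (b - a) * ∑ T ∈ U.powersetCard a, φ T := by
    have h₂ : ∀ S ∈ U.powersetCard b, ∑ T ∈ S.powersetCard a, φ T =
        ∑ T ∈ U.powersetCard a, if T ⊆ S then φ T else 0 := by
      intro S hS
      rw [← Finset.sum_filter]
      refine Finset.sum_congr (Finset.ext fun T => ?_) fun _ _ => rfl
      have hSU := (Finset.mem_powersetCard.1 hS).1
      simp only [Finset.mem_filter, Finset.mem_powersetCard]
      exact ⟨fun h => ⟨⟨h.1.trans hSU, h.2⟩, h.1⟩, fun h => ⟨h.2, h.1.2⟩⟩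
    rw [Finset.sum_congr rfl h₂, Finset.sum_comm, Finset.mul_sum]
    refine Finset.sum_congr rfl fun T hT => ?_
    obtain ⟨hTU, rfl⟩ := Finset.mem_powersetCard.1 hT
    rw [← Finset.sum_filter, Finset.sum_const, card_filter_subset_powersetCard hTU hab,
      nsmul_eq_mul]
  have h₂ : average (U.powersetCard b) (fun S => average (S.powersetCard a) φ) =
      (∑ S ∈ U.powersetCard b, ∑ T ∈ S.powersetCard a, φ T) /
        (U.card.choose b * b.choose a : ℕ) := by
    rw [average, Finset.card_powersetCard, Nat.cast_mul, mul_comm, ← div_div]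
    congr 1
    rw [Finset.sum_div]
    refine Finset.sum_congr rfl fun S hS => ?_
    rw [average, Finset.card_powersetCard, (Finset.mem_powersetCard.1 hS).2]
  have h₃ : ((U.card - a).choose (b - a) : ℝ) ≠ 0 := by
    exact_mod_cast (Nat.choose_pos (by omega)).ne'
  rw [h₂, h₁, Nat.choose_mul hab, average, Finset.card_powersetCard, Nat.cast_mul,
    mul_comm, mul_div_mul_right _ _ h₃]

/-! ### From strong points to the weight of a random set -/

theorem isEdge_kind_unique {n : ℕ} {f : Cube n → Bool} {κ κ' : EdgeKind} {i : Fin n} {x : Cube n}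
    (h : IsEdge f κ i x) (h' : IsEdge f κ' i x) : κ = κ' :=
  h.2.symm.trans h'.2

-- Goodness leaves the returned kind open, but a returned edge is genuine and an edge has only one
-- kind.
open Classical in
theorem half_le_expect_of_isGoodPair {n : ℕ} {f : Cube n → Bool} {κ : EdgeKind} {i : Fin n}
    {x : Cube n} {S : Finset (Fin n)} (h : IsGoodPair f κ i x S) :
    1 / 2 ≤ (aeSearch x (insert i S)).expect f fun o => if o = some (i, κ) then 1 else 0 := by
  have h₂ := h.2
  rw [QueryAlg.toOuterMeasure_run, ENNReal.le_ofReal_iff_toReal_le (by simp)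
    (QueryAlg.expect_nonneg fun b => by split_ifs <;> simp)] at h₂
  rw [ENNReal.toReal_div, ENNReal.toReal_one, ENNReal.toReal_ofNat] at h₂
  refine h₂.trans (QueryAlg.expect_mono_support fun o ho => ?_)
  by_cases hi : ∃ κ', o = some (i, κ')
  · obtain ⟨κ', rfl⟩ := hi
    rw [isEdge_kind_unique (isEdge_of_mem_support_aeSearch ho) h.1]
    simp
  · rw [if_neg (show o ∉ {o | ∃ κ', o = some (i, κ')} from hi)]
    split_ifs <;> simp

open Classical in
/-- The fraction of the points that are `j`-strong and good with `S`. -/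
noncomputable def goodFraction {n : ℕ} (f : Cube n → Bool) (κ : EdgeKind) (i : Fin n) (j : ℕ)
    (S : Finset (Fin n)) : ℝ :=
  ((Finset.univ.filter fun x : Cube n => IsStrong f κ i j x ∧ IsGoodPair f κ i x S).card : ℝ) /
    2 ^ n

theorem goodFraction_nonneg {n : ℕ} (f : Cube n → Bool) (κ : EdgeKind) (i : Fin n) (j : ℕ)
    (S : Finset (Fin n)) : 0 ≤ goodFraction f κ i j S := by
  unfold goodFraction
  positivity

/-- This is why `goodFraction` counts strong points only: divided by the score it stays at most `1`,
while its mean is still at least `3/4`. -/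
theorem goodFraction_le_scoreAt {n : ℕ} (f : Cube n → Bool) (κ : EdgeKind) (i : Fin n) (j : ℕ)
    (S : Finset (Fin n)) : goodFraction f κ i j S ≤ scoreAt f κ i j := by
  classical
  unfold goodFraction scoreAt
  push_cast
  gcongr with x
  exact fun h => h.1

/-- Double counting of good pairs: every strong point is good with at least `3/4` of the sets. -/
theorem scoreAt_le_average_goodFraction {n : ℕ} (f : Cube n → Bool) (κ : EdgeKind) (i : Fin n)
    {j : ℕ} (hj : 2 ^ j ≤ n) :
    3 / 4 * (scoreAt f κ i j : ℝ) ≤ average (scaleSets i j) (goodFraction f κ i j) := by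
  classical
  have hne : (scaleSets i j).Nonempty := by
    refine Finset.powersetCard_nonempty.2 ?_
    rw [Finset.card_erase_of_mem (Finset.mem_univ i), Finset.card_univ, Fintype.card_fin]
    omega
  have hc : (0 : ℝ) < (scaleSets i j).card := by exact_mod_cast hne.card_pos
  unfold average goodFraction scoreAt
  push_cast
  rw [← Finset.sum_div, div_right_comm, ← mul_div_assoc]
  gcongr
  rw [le_div_iff₀ hc]
  have h := Finset.sum_card_bipartiteAbove_eq_sum_card_bipartiteBelow
    (s := scaleSets i j) (t := Finset.univ.filter fun x : Cube n => IsStrong f κ i j x)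
    fun S x => IsGoodPair f κ i x S
  simp only [Finset.bipartiteAbove, Finset.bipartiteBelow, Finset.filter_filter] at h
  rw [← Nat.cast_sum, h, Nat.cast_sum, mul_right_comm, mul_comm, ← nsmul_eq_mul]
  exact Finset.card_nsmul_le_sum _ _ _ fun x hx => (Finset.mem_filter.1 hx).2

theorem goodFraction_le_hitProb {n : ℕ} (f : Cube n → Bool) (b : Bool) (i : Fin n) (j : ℕ)
    (S : Finset (Fin n)) :
    1 / 2 * goodFraction f (kindOf b) i j S ≤ hitProb f b (probe (insert i S)) i := by
  classical
  have hcard : (Fintype.card (Cube n) : ℝ) = 2 ^ n := by simp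
  rw [goodFraction, hitProb, probe, QueryAlg.expect, hcard, ← mul_div_assoc]
  gcongr
  rw [mul_comm, ← nsmul_eq_mul, ← Finset.sum_const, Finset.sum_filter]
  gcongr with x
  rw [QueryAlg.expect_bind]
  split_ifs with hx
  · exact half_le_expect_of_isGoodPair hx.2
  · exact QueryAlg.expect_nonneg fun o => by
      simp only [QueryAlg.expect]
      split_ifs <;> simp

theorem hitProb_subProbe {n : ℕ} (f : Cube n → Bool) (b : Bool) {k : ℕ} {S : Finset (Fin n)}
    (hk : 2 ^ k ≤ S.card) (i : Fin n) :
    hitProb f b (subProbe k S) i =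
      average (S.powersetCard (2 ^ k)) fun T => hitProb f b (probe T) i := by
  rw [hitProb, subProbe, QueryAlg.expect_bind,
    QueryAlg.expect_pick f (Finset.powersetCard_nonempty.2 hk)]
  rfl

/-- At the scales `k ≤ j` the scores bound the contribution of a direction to the weight of a random
set of size `2 ^ j`. -/
theorem min_scoreAt_le_average {n : ℕ} (f : Cube n → Bool) (b : Bool) (i : Fin n) {j k : ℕ}
    (hkj : k ≤ j) (hj : 2 ^ j ≤ n) :
    min ((scoreAt f (kindOf b) i j : ℝ) * 2 ^ j) (scoreAt f (kindOf !b) i k * 2 ^ k) / (4 * n) ≤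
      average ((Finset.univ : Finset (Fin n)).powersetCard (2 ^ j)) fun S =>
        if i ∈ S then min (hitProb f b (probe S) i) (hitProb f (!b) (subProbe k S) i) else 0 := by
  have hk2 : 2 ^ k ≤ 2 ^ j := Nat.pow_le_pow_right (by norm_num) hkj
  have hj1 : 2 ^ j - 1 + 1 = 2 ^ j := Nat.sub_add_cancel Nat.one_le_two_pow
  have hk1 : 2 ^ k - 1 + 1 = 2 ^ k := Nat.sub_add_cancel Nat.one_le_two_pow
  have hk0 : 1 ≤ 2 ^ k := Nat.one_le_two_pow
  have hn : (0 : ℝ) < n := by exact_mod_cast (Nat.one_le_two_pow.trans hj : 1 ≤ n)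
  set s : ℝ := (scoreAt f (kindOf b) i j : ℝ) with hs
  set t : ℝ := (scoreAt f (kindOf !b) i k : ℝ) with ht
  set g := goodFraction f (kindOf b) i j with hg
  set h := goodFraction f (kindOf !b) i k with hh
  set H : Finset (Fin n) → ℝ := fun S => average (S.powersetCard (2 ^ k - 1)) h with hH
  set ρ : ℝ := 2 ^ k / 2 ^ j with hρ
  have hs₀ : 0 ≤ s := NNReal.coe_nonneg _
  have ht₀ : 0 ≤ t := NNReal.coe_nonneg _
  set φ : Finset (Fin n) → ℝ := fun S =>
    if i ∈ S then min (hitProb f b (probe S) i) (hitProb f (!b) (subProbe k S) i) else 0 with hφ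
  have hφ₀ : ∀ S, 0 ≤ φ S := fun S => by
    simp only [hφ]
    split_ifs
    · exact le_min (hitProb_nonneg _ _ _ _) (hitProb_nonneg _ _ _ _)
    · exact le_rfl
  -- Vanishing scores are split off because the normalization below divides by `s` and `t`.
  rcases hs₀.eq_or_lt with hs0 | hs0
  · rw [← hs0, zero_mul, min_eq_left (mul_nonneg ht₀ (by positivity)), zero_div]
    exact average_nonneg fun S _ => hφ₀ S
  rcases ht₀.eq_or_lt with ht0 | ht0
  · rw [← ht0, zero_mul, min_eq_right (mul_nonneg hs₀ (by positivity)), zero_div]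
    exact average_nonneg fun S _ => hφ₀ S
  set μ : ℝ := min s (ρ * t) with hμ
  have hρ₀ : 0 < ρ := by positivity
  have hμ₀ : 0 ≤ μ := le_min hs₀ (mul_nonneg hρ₀.le ht₀)
  -- For `a = g S / s` and `b = H S / t` in `[0, 1]`, both `a` and `b` are at least `a + b - 1`, so
  -- `min (s * a) (ρ * t * b) ≥ μ * (a + b - 1)`. The factor `1/2` is the success probability of a
  -- good pair.
  have hins : ∀ S ∈ scaleSets i j, 1 / 2 * (μ * (g S / s + H S / t - 1)) ≤ φ (insert i S) := by
    intro S hS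
    obtain ⟨hSi, hSc⟩ := Finset.mem_powersetCard.1 hS
    have hiS : i ∉ S := fun hm => Finset.notMem_erase i _ (hSi hm)
    have hcard : (insert i S).card = 2 ^ j := by
      rw [Finset.card_insert_of_notMem hiS, hSc, hj1]
    have hne : (S.powersetCard (2 ^ k - 1)).Nonempty :=
      Finset.powersetCard_nonempty.2 (by omega)
    have hg₁ : g S / s ≤ 1 := (div_le_one hs0).2 (goodFraction_le_scoreAt _ _ _ _ _)
    have hH₁ : H S / t ≤ 1 := (div_le_one ht0).2 ((average_mono fun T _ =>
      goodFraction_le_scoreAt f (kindOf !b) i k T).trans_eq (average_const hne _))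
    have hg₀ : 0 ≤ g S / s := div_nonneg (goodFraction_nonneg _ _ _ _ _) hs₀
    have hH₀ : 0 ≤ H S / t := div_nonneg (average_nonneg fun T _ => goodFraction_nonneg _ _ _ _ _) ht₀
    -- The factor `ρ` is the probability that the random `2 ^ k`-subset contains `i`.
    have hq : 1 / 2 * (ρ * H S) ≤ hitProb f (!b) (subProbe k (insert i S)) i := by
      rw [hitProb_subProbe f (!b) (by rw [hcard]; exact hk2)]
      have h₁ := average_insert_le (Finset.mem_insert_self i S) (c := 2 ^ k - 1)
        (by rw [hcard, hk1]; exact hk2) (fun T => hitProb_nonneg f (!b) (probe T) i)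
      rw [hk1, hcard, Finset.erase_insert hiS] at h₁
      refine le_trans ?_ h₁
      push_cast
      rw [mul_left_comm, ← average_const_mul]
      exact mul_le_mul_of_nonneg_left
        (average_mono fun T _ => goodFraction_le_hitProb f (!b) i k T) hρ₀.le
    simp only [hφ, Finset.mem_insert_self, if_true]
    refine le_min (le_trans ?_ (goodFraction_le_hitProb f b i j S)) (le_trans ?_ hq)
    · have h₁ : μ * (g S / s + H S / t - 1) ≤ s * (g S / s) :=
        (mul_le_mul_of_nonneg_left (by linarith) hμ₀).trans
          (mul_le_mul_of_nonneg_right (min_le_left _ _) hg₀)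
      rw [mul_div_cancel₀ _ hs0.ne'] at h₁
      linarith
    · have h₁ : μ * (g S / s + H S / t - 1) ≤ ρ * t * (H S / t) :=
        (mul_le_mul_of_nonneg_left (by linarith) hμ₀).trans
          (mul_le_mul_of_nonneg_right (min_le_right _ _) hH₀)
      rw [mul_assoc, mul_div_cancel₀ _ ht0.ne'] at h₁
      linarith
  have hU : ((Finset.univ : Finset (Fin n)).erase i).card = n - 1 := by
    rw [Finset.card_erase_of_mem (Finset.mem_univ i), Finset.card_univ, Fintype.card_fin]
  have hne : (scaleSets i j).Nonempty := Finset.powersetCard_nonempty.2 (by omega)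
  have h₁ := average_insert_le (Finset.mem_univ i) (c := 2 ^ j - 1)
    (by rw [hj1, Finset.card_univ, Fintype.card_fin]; exact hj) hφ₀
  rw [hj1, Finset.card_univ, Fintype.card_fin] at h₁
  -- A random subset of a random set is again uniform, so `H` has the same mean as `h` at scale `k`.
  have hHavg : 3 / 4 * t ≤ average (scaleSets i j) H := by
    refine (scoreAt_le_average_goodFraction f (kindOf !b) i (hk2.trans hj)).trans_eq ?_
    exact (average_average_powersetCard (by omega) (by omega) h).symm
  have h₂ : 1 / 2 * (μ * (1 / 2)) ≤ average (scaleSets i j) fun S => φ (insert i S) := by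
    refine le_trans ?_ (average_mono hins)
    rw [average_const_mul, average_const_mul, average_sub, average_add, average_const hne]
    have hg' : 3 / 4 ≤ average (scaleSets i j) fun S => g S / s := by
      simp only [div_eq_inv_mul _ s]
      rw [average_const_mul, ← div_eq_inv_mul, le_div_iff₀ hs0]
      exact scoreAt_le_average_goodFraction f (kindOf b) i hj
    have hH' : 3 / 4 ≤ average (scaleSets i j) fun S => H S / t := by
      simp only [div_eq_inv_mul _ t]
      rw [average_const_mul, ← div_eq_inv_mul, le_div_iff₀ ht0]
      exact hHavg
    gcongr
    linarith
  refine le_trans ?_ ((mul_le_mul_of_nonneg_left h₂ (by positivity)).trans h₁)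
  have h₃ : min (s * 2 ^ j) (t * 2 ^ k) = μ * 2 ^ j := by
    rw [hμ, min_mul_of_nonneg _ _ (by positivity), hρ]
    congr 1
    field_simp
  rw [h₃]
  push_cast
  apply le_of_eq
  field_simp
  ring

/-! ### Summing the weights over scales and directions -/

/-- The pairs of scales considered for sets in the cube of dimension `n`, with the kind of edges
that is searched for at the larger scale. -/
def scalePairs (n : ℕ) : Finset (Bool × ℕ × ℕ) :=
  Finset.univ ×ˢ Finset.Icc 1 (Nat.log 2 n.sqrt) ×ˢ Finset.Icc 1 (Nat.log 2 n.sqrt)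

theorem two_pow_le_sqrt_of_mem_scalePairs {n : ℕ} {p : Bool × ℕ × ℕ} (hp : p ∈ scalePairs n) :
    2 ^ p.2.1 ≤ n.sqrt := by
  simp only [scalePairs, Finset.mem_product, Finset.mem_Icc] at hp
  have h := hp.2.1
  refine (Nat.pow_le_pow_right (by norm_num) h.2).trans (Nat.pow_log_le_self 2 fun h0 => ?_)
  rw [h0] at h
  simp at h
  omega

/-- The expected weight of a random set at a pair of scales. -/
noncomputable def meanWeight {n : ℕ} (f : Cube n → Bool) (p : Bool × ℕ × ℕ) : ℝ :=
  average ((Finset.univ : Finset (Fin n)).powersetCard (2 ^ p.2.1)) (weight f p.1 p.2.2)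

theorem meanWeight_eq_sum {n : ℕ} (f : Cube n → Bool) (p : Bool × ℕ × ℕ) :
    meanWeight f p = ∑ i, average ((Finset.univ : Finset (Fin n)).powersetCard (2 ^ p.2.1)) fun S =>
      if i ∈ S then min (hitProb f p.1 (probe S) i) (hitProb f (!p.1) (subProbe p.2.2 S) i)
        else 0 := by
  rw [← average_sum, meanWeight]
  congr 1
  funext S
  rw [weight, ← Finset.sum_filter, Finset.filter_mem_eq_inter, Finset.univ_inter]

theorem exists_score_eq {n : ℕ} (f : Cube n → Bool) {Λ : ℕ} (hΛ : 1 ≤ Λ) (κ : EdgeKind)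
    (i : Fin n) : ∃ j ∈ Finset.Icc 1 Λ,
      (score f Λ κ i : ℝ) = scoreAt f κ i j * 2 ^ j / Real.sqrt n := by
  obtain ⟨j, hj, h⟩ := Finset.exists_mem_eq_sup (Finset.Icc 1 Λ) ⟨1, by simpa using hΛ⟩
    fun j => scoreAt f κ i j * (2 ^ j / NNReal.sqrt n)
  refine ⟨j, hj, ?_⟩
  rw [score, h]
  push_cast
  rw [mul_div_assoc]

/-- Each direction is charged to the single pair of scales attaining its two scores, the larger
scale taken first; all other terms are nonnegative. -/
theorem sum_min_score_le {n : ℕ} (f : Cube n → Bool) {Λ : ℕ} (hn : 1 ≤ n)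
    (hΛ : (2 : ℝ) ^ Λ ≤ Real.sqrt n) :
    ∑ i : Fin n, ((min (score f Λ EdgeKind.monotone i) (score f Λ EdgeKind.antiMonotone i) :
      ℝ≥0) : ℝ) ≤ 4 * Real.sqrt n * ∑ p ∈ scalePairs n, meanWeight f p := by
  have hn' : (0 : ℝ) < n := by exact_mod_cast hn
  have hsq : 0 < Real.sqrt n := Real.sqrt_pos.2 hn'
  have hΛ' : 2 ^ Λ ≤ n.sqrt := by
    rw [Nat.le_sqrt']
    rw [Real.le_sqrt (by positivity) (by positivity)] at hΛ
    exact_mod_cast hΛ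
  have hlog : Λ ≤ Nat.log 2 n.sqrt := by
    have := Nat.log_mono_right (b := 2) hΛ'
    rwa [Nat.log_pow (by norm_num)] at this
  simp only [meanWeight_eq_sum]
  rw [Finset.sum_comm, Finset.mul_sum]
  refine Finset.sum_le_sum fun i _ => ?_
  have hterm₀ : ∀ p : Bool × ℕ × ℕ, 0 ≤
      average ((Finset.univ : Finset (Fin n)).powersetCard (2 ^ p.2.1)) fun S =>
        if i ∈ S then min (hitProb f p.1 (probe S) i) (hitProb f (!p.1) (subProbe p.2.2 S) i)
          else 0 := fun p => average_nonneg fun S _ => by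
    split_ifs
    · exact le_min (hitProb_nonneg _ _ _ _) (hitProb_nonneg _ _ _ _)
    · exact le_rfl
  rcases Nat.eq_zero_or_pos Λ with rfl | hpos
  · simp only [score, Finset.Icc_eq_empty_of_lt zero_lt_one, Finset.sup_empty, min_self]
    simp only [bot_eq_zero', NNReal.coe_zero]
    exact mul_nonneg (by positivity) (Finset.sum_nonneg fun p _ => hterm₀ p)
  obtain ⟨j, hj, hj'⟩ := exists_score_eq f hpos EdgeKind.monotone i
  obtain ⟨k, hk, hk'⟩ := exists_score_eq f hpos EdgeKind.antiMonotone i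
  have hmem : ∀ b, ∀ j ∈ Finset.Icc 1 Λ, ∀ k ∈ Finset.Icc 1 Λ, (b, j, k) ∈ scalePairs n := by
    intro b j hj k hk
    simp only [scalePairs, Finset.mem_product, Finset.mem_univ, true_and, Finset.mem_Icc] at *
    omega
  have hle : ∀ p ∈ scalePairs n, 2 ^ p.2.1 ≤ n := fun p hp =>
    (two_pow_le_sqrt_of_mem_scalePairs hp).trans (Nat.sqrt_le_self n)
  -- The Boolean records which kind has the larger scale, so that `k ≤ j` may be assumed.
  have main : ∃ p ∈ scalePairs n, p.2.2 ≤ p.2.1 ∧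
      ((min (score f Λ EdgeKind.monotone i) (score f Λ EdgeKind.antiMonotone i) : ℝ≥0) : ℝ) =
        min ((scoreAt f (kindOf p.1) i p.2.1 : ℝ) * 2 ^ p.2.1)
          (scoreAt f (kindOf !p.1) i p.2.2 * 2 ^ p.2.2) / Real.sqrt n := by
    rw [NNReal.coe_min, hj', hk']
    rcases le_total k j with hkj | hjk
    · exact ⟨(true, j, k), hmem _ _ hj _ hk, hkj, (min_div_div_right hsq.le _ _)⟩
    · refine ⟨(false, k, j), hmem _ _ hk _ hj, hjk, ?_⟩
      rw [min_comm]
      exact min_div_div_right hsq.le _ _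
  obtain ⟨p, hp, hkj, heq⟩ := main
  rw [heq]
  have h₁ := min_scoreAt_le_average f p.1 i hkj (hle p hp)
  have h₂ := Finset.single_le_sum (f := fun p : Bool × ℕ × ℕ =>
    average ((Finset.univ : Finset (Fin n)).powersetCard (2 ^ p.2.1)) fun S =>
      if i ∈ S then min (hitProb f p.1 (probe S) i) (hitProb f (!p.1) (subProbe p.2.2 S) i)
        else 0) (fun p _ => hterm₀ p) hp
  refine le_trans ?_ (mul_le_mul_of_nonneg_left (h₁.trans h₂) (by positivity))
  apply le_of_eq
  have h₃ : (n : ℝ) = Real.sqrt n * Real.sqrt n := (Real.mul_self_sqrt hn'.le).symm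
  rw [div_eq_iff hsq.ne']
  field_simp
  rw [pow_two, ← h₃]

/-! ### The full search over dyadic levels: success and cost -/

/-- The number of searches in a trial at the level `h`. -/
noncomputable def searchCount (n h : ℕ) : ℕ := ⌈√√(n : ℝ) * 2 ^ h⌉₊

/-- The number of repetitions of a trial at the level `h`. -/
noncomputable def trialCount (D : ℝ) (h : ℕ) : ℕ := ⌈80 * (1 / 2) ^ h * D⌉₊

/-- Trials at all pairs of scales and all levels up to `H`. -/
noncomputable def violationSearch (n : ℕ) (D : ℝ) (H : ℕ) : QueryAlg n (Option (EdgePair n)) :=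
  QueryAlg.tryAll (scalePairs n) fun p => QueryAlg.tryAll (Finset.range (H + 1)) fun h =>
    QueryAlg.tryAll (Finset.range (trialCount D h)) fun _ =>
      trial p.1 p.2.1 p.2.2 (searchCount n h)

theorem builtFromAESearch_violationSearch (n : ℕ) (D : ℝ) (H : ℕ) :
    BuiltFromAESearch (violationSearch n D H) :=
  QueryAlg.builtFromAESearch_tryAll fun _ => QueryAlg.builtFromAESearch_tryAll fun _ =>
    QueryAlg.builtFromAESearch_tryAll fun _ => builtFromAESearch_trial _ _ _ _

theorem isViolation_of_mem_support_violationSearch {n : ℕ} {D : ℝ} {H : ℕ} {f : Cube n → Bool}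
    {v : EdgePair n} (h : some v ∈ ((violationSearch n D H).run f).support) : v.IsViolation f := by
  obtain ⟨p, h⟩ := QueryAlg.exists_mem_support_of_tryAll h
  obtain ⟨l, h⟩ := QueryAlg.exists_mem_support_of_tryAll h
  obtain ⟨-, h⟩ := QueryAlg.exists_mem_support_of_tryAll h
  exact isViolation_of_mem_support_trial h

/-- If `w` reaches level `H + 1`, the new term `(1 / 2) ^ (H + 1)` equals the growth of the left
side; otherwise the left side is negative. -/
theorem sub_le_sum_dyadic {w : ℝ} (hw : w ≤ 1) (H : ℕ) :
    w - (1 / 2) ^ H ≤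
      ∑ h ∈ Finset.range (H + 1), (1 / 2) ^ h * if (1 / 2) ^ h ≤ w then (1 : ℝ) else 0 := by
  induction H with
  | zero =>
    simp only [zero_add, Finset.sum_range_one, pow_zero, one_mul]
    split_ifs <;> linarith
  | succ H ih =>
    have hp : (0 : ℝ) < (1 / 2) ^ (H + 1) := by positivity
    by_cases h : (1 / 2 : ℝ) ^ (H + 1) ≤ w
    · rw [Finset.sum_range_succ, if_pos h, mul_one]
      rw [pow_succ] at *
      linarith
    · exact (sub_nonpos.2 (not_le.1 h).le).trans
        (Finset.sum_nonneg fun i _ => by split_ifs <;> positivity)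

/-- A trial at level `h` fails with probability at most `exp (-x / 5)`, where `x` is the chance of
weight at least `2^(-h)`. Over `80 * 2^(-h) * D` repetitions and all levels, the exponents add up to
`16 * D` times the mean weight, less the truncation error `2^(-H)`. -/
theorem failure_violationSearch_le {n : ℕ} {f : Cube n → Bool} {D : ℝ} (hD : 0 < D) {H : ℕ}
    (hmean : 1 / (4 * D) ≤ ∑ p ∈ scalePairs n, meanWeight f p)
    (hH : (scalePairs n).card * (1 / 2) ^ H ≤ 1 / (8 * D)) :
    (violationSearch n D H).failure f ≤ 1 / 3 := by
  classical
  set x : Bool × ℕ × ℕ → ℕ → ℝ := fun p h =>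
    average ((Finset.univ : Finset (Fin n)).powersetCard (2 ^ p.2.1))
      fun S => if (1 / 2) ^ h ≤ weight f p.1 p.2.2 S then 1 else 0 with hx
  have hx₀ : ∀ p h, 0 ≤ x p h := fun p h => average_nonneg fun S _ => by split_ifs <;> simp
  have htrial : ∀ p ∈ scalePairs n, ∀ h,
      (trial p.1 p.2.1 p.2.2 (searchCount n h)).failure f ≤ Real.exp (-(x p h / 5)) := by
    intro p hp h
    have hj := two_pow_le_sqrt_of_mem_scalePairs hp
    refine (failure_trial_le f p.1 (w := (1 / 2) ^ h) (hj.trans (Nat.sqrt_le_self n)) ?_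
      (by positivity)).trans ?_
    · have h₁ : √√(n : ℝ) ≤ searchCount n h * (1 / 2) ^ h := by
        rw [one_div, inv_pow, ← div_eq_mul_inv, le_div_iff₀ (by positivity)]
        exact Nat.le_ceil _
      calc (2 : ℝ) ^ p.2.1 ≤ n.sqrt := by exact_mod_cast hj
        _ ≤ √n := Real.nat_sqrt_le_real_sqrt
        _ = √√(n : ℝ) ^ 2 := (Real.sq_sqrt (Real.sqrt_nonneg _)).symm
        _ ≤ _ := by gcongr
    · refine le_trans (le_of_eq ?_) (Real.one_sub_le_exp_neg _)
      simp only [hx]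
      ring
  have hpair : ∀ p ∈ scalePairs n, (QueryAlg.tryAll (Finset.range (H + 1)) fun h =>
      QueryAlg.tryAll (Finset.range (trialCount D h)) fun _ =>
        trial p.1 p.2.1 p.2.2 (searchCount n h)).failure f ≤
          Real.exp (-(16 * D * (meanWeight f p - (1 / 2) ^ H))) := by
    intro p hp
    have hne : ((Finset.univ : Finset (Fin n)).powersetCard (2 ^ p.2.1)).Nonempty := by
      refine Finset.powersetCard_nonempty.2 ?_
      simpa using (two_pow_le_sqrt_of_mem_scalePairs hp).trans (Nat.sqrt_le_self n)
    have h₁ : meanWeight f p - (1 / 2) ^ H ≤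
        ∑ h ∈ Finset.range (H + 1), (1 / 2) ^ h * x p h := by
      simp only [hx, ← average_const_mul]
      rw [← average_sum, ← average_const hne ((1 / 2) ^ H), meanWeight, ← average_sub]
      exact average_mono fun S _ => sub_le_sum_dyadic (weight_le_one f _ _ S) H
    rw [QueryAlg.failure_tryAll]
    refine (Finset.prod_le_prod (fun h _ => QueryAlg.failure_nonneg _ _)
      (g := fun h => Real.exp (-(16 * D * ((1 / 2) ^ h * x p h)))) fun h _ => ?_).trans ?_
    · rw [QueryAlg.failure_tryAll, Finset.prod_const, Finset.card_range]
      refine (pow_le_pow_left₀ (QueryAlg.failure_nonneg _ _) (htrial p hp h) _).trans ?_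
      rw [← Real.exp_nat_mul]
      refine Real.exp_le_exp.2 ?_
      have h₂ : 80 * (1 / 2) ^ h * D ≤ (trialCount D h : ℝ) := Nat.le_ceil _
      nlinarith [mul_le_mul_of_nonneg_right h₂ (hx₀ p h)]
    · rw [← Real.exp_sum, Finset.sum_neg_distrib, ← Finset.mul_sum]
      gcongr
  rw [violationSearch, QueryAlg.failure_tryAll]
  refine (Finset.prod_le_prod (fun h _ => QueryAlg.failure_nonneg _ _) hpair).trans ?_
  rw [← Real.exp_sum, Finset.sum_neg_distrib, ← Finset.mul_sum, Finset.sum_sub_distrib,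
    Finset.sum_const, nsmul_eq_mul]
  -- Truncation costs at most half of the mean weight; the remaining exponent `2` suffices because
  -- `exp 2 ≥ 3`.
  have h₁ : 16 * D * (1 / (4 * D) - 1 / (8 * D)) = 2 := by
    field_simp
    norm_num
  have h₂ : 2 ≤ 16 * D * (∑ p ∈ scalePairs n, meanWeight f p -
      (scalePairs n).card * (1 / 2) ^ H) := by
    refine h₁.symm.trans_le ?_
    gcongr
  refine (Real.exp_le_exp.2 (neg_le_neg h₂)).trans ?_
  rw [Real.exp_neg, one_div]
  gcongr
  linarith [Real.add_one_le_exp (2 : ℝ)]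

theorem card_scalePairs_le (n : ℕ) :
    ((scalePairs n).card : ℝ) ≤ 2 * Real.logb 2 n ^ 2 := by
  have h₁ : (Nat.log 2 n.sqrt : ℝ) ≤ Real.logb 2 n :=
    (Nat.cast_le.2 (Nat.log_mono_right (Nat.sqrt_le_self n))).trans (Real.natLog_le_logb n 2)
  simp only [scalePairs, Finset.card_product, Finset.card_univ, Fintype.card_bool, Nat.card_Icc,
    Nat.add_sub_cancel]
  push_cast
  rw [← pow_two]
  gcongr

theorem one_le_logb_two {n : ℕ} (hn : 2 ≤ n) : 1 ≤ Real.logb 2 n := by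
  rw [Real.le_logb_iff_rpow_le (by norm_num) (by positivity), Real.rpow_one]
  exact_mod_cast hn

theorem queries_violationSearch_le {n : ℕ} (hn : 2 ≤ n) {D : ℝ} (hD : 0 < D) {H : ℕ}
    (hH : (2 : ℝ) ^ H ≤ 32 * Real.logb 2 n ^ 2 * D) :
    ((violationSearch n D H).queries : ℝ) ≤
      6272 * Real.logb 2 n ^ 5 * (D * √√(n : ℝ)) * (H + 1) := by
  set L := Real.logb 2 n with hL
  have hL₁ : 1 ≤ L := one_le_logb_two hn
  have hroot : 1 ≤ √√(n : ℝ) := by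
    rw [Real.one_le_sqrt, Real.one_le_sqrt]
    exact_mod_cast (by omega : 1 ≤ n)
  set Q : ℕ := ⌈4 * L⌉₊ + 2 with hQ
  have hQ' : (Q : ℝ) ≤ 7 * L := by
    have := Nat.ceil_lt_add_one (a := 4 * L) (by positivity)
    rw [hQ]
    push_cast
    linarith
  -- Rounding the number of trials up to an integer can add `2^h` times `n^(1/4)` searches at high
  -- levels; the bound on `2 ^ H` absorbs this at the price of `L ^ 2`. The constant is `160 + 64`.
  have hlevel : ∀ h ∈ Finset.range (H + 1),
      (trialCount D h * searchCount n h : ℝ) ≤ 224 * L ^ 2 * (D * √√(n : ℝ)) := by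
    intro h hh
    have hh' : h ≤ H := by simpa [Nat.lt_succ_iff] using hh
    have h2 : (1 : ℝ) ≤ 2 ^ h := one_le_pow₀ (by norm_num)
    have h2H : (2 : ℝ) ^ h ≤ 2 ^ H := pow_le_pow_right₀ (by norm_num) hh'
    have hR : (trialCount D h : ℝ) ≤ 80 * (1 / 2) ^ h * D + 1 :=
      (Nat.ceil_lt_add_one (by positivity)).le
    have hM : (searchCount n h : ℝ) ≤ 2 * (√√(n : ℝ) * 2 ^ h) := by
      have := (Nat.ceil_lt_add_one (a := √√(n : ℝ) * 2 ^ h) (by positivity)).le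
      have h1 : 1 ≤ √√(n : ℝ) * 2 ^ h := one_le_mul_of_one_le_of_one_le hroot h2
      rw [searchCount]
      linarith
    have hinv : (1 / 2 : ℝ) ^ h * 2 ^ h = 1 := by rw [← mul_pow]; norm_num
    have hL2 : 1 ≤ L ^ 2 := one_le_pow₀ hL₁
    calc (trialCount D h * searchCount n h : ℝ)
        ≤ (80 * (1 / 2) ^ h * D + 1) * (2 * (√√(n : ℝ) * 2 ^ h)) := by gcongr
      _ = 160 * D * √√(n : ℝ) * ((1 / 2) ^ h * 2 ^ h) + 2 * √√(n : ℝ) * 2 ^ h := by ring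
      _ ≤ 160 * D * √√(n : ℝ) * L ^ 2 + 2 * √√(n : ℝ) * (32 * L ^ 2 * D) := by
        rw [hinv]
        gcongr
        exact h2H.trans hH
      _ = _ := by ring
  have hnat : (violationSearch n D H).queries ≤ ∑ _p ∈ scalePairs n,
      ∑ h ∈ Finset.range (H + 1), trialCount D h * (2 * searchCount n h * Q) := by
    refine (QueryAlg.queries_tryAll_le _ _).trans (Finset.sum_le_sum fun p _ =>
      (QueryAlg.queries_tryAll_le _ _).trans (Finset.sum_le_sum fun h _ =>
        (QueryAlg.queries_tryAll_le _ _).trans ?_))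
    rw [Finset.sum_const, Finset.card_range, smul_eq_mul]
    exact Nat.mul_le_mul_left _ (queries_trial_le _ _ _ _)
  rw [Finset.sum_const, smul_eq_mul] at hnat
  have hcast : ((violationSearch n D H).queries : ℝ) ≤ (scalePairs n).card *
      ∑ h ∈ Finset.range (H + 1), (trialCount D h * (2 * searchCount n h * Q) : ℝ) := by
    exact_mod_cast hnat
  have hsum : ∑ h ∈ Finset.range (H + 1), (trialCount D h * (2 * searchCount n h * Q) : ℝ) ≤
      (H + 1) * (14 * L * (224 * L ^ 2 * (D * √√(n : ℝ)))) := by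
    refine (Finset.sum_le_card_nsmul _ _ (14 * L * (224 * L ^ 2 * (D * √√(n : ℝ))))
      fun h hh => ?_).trans_eq ?_
    · calc (trialCount D h * (2 * searchCount n h * Q) : ℝ)
          = (2 * Q) * (trialCount D h * searchCount n h) := by ring
        _ ≤ (2 * (7 * L)) * (224 * L ^ 2 * (D * √√(n : ℝ))) :=
          mul_le_mul (by gcongr) (hlevel h hh) (by positivity) (by positivity)
        _ = _ := by ring
    · rw [Finset.card_range, nsmul_eq_mul]
      push_cast
      ring
  calc ((violationSearch n D H).queries : ℝ)
      ≤ (2 * L ^ 2) * ((H + 1) * (14 * L * (224 * L ^ 2 * (D * √√(n : ℝ))))) :=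
        hcast.trans (mul_le_mul (card_scalePairs_le n) hsum
          (Finset.sum_nonneg fun h _ => by positivity) (by positivity))
    _ = _ := by ring

/-! ### Choice of parameters and the final bounds -/

theorem rpow_three_div_four (n : ℕ) : (n : ℝ) ^ (3 / 4 : ℝ) = √n * √√(n : ℝ) := by
  rcases Nat.eq_zero_or_pos n with rfl | hn
  · simp
  · have hn' : (0 : ℝ) < n := by exact_mod_cast hn
    rw [Real.sqrt_eq_rpow, Real.sqrt_eq_rpow, ← Real.rpow_mul hn'.le, ← Real.rpow_add hn']
    norm_num

theorem logb_le_logb_div {n : ℕ} {ε : ℝ} (hn : 2 ≤ n) (hε : 0 < ε) (hε₁ : ε ≤ 1) :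
    Real.logb 2 n ≤ Real.logb 2 (n / ε) := by
  have hn' : (0 : ℝ) < n := by positivity
  exact Real.logb_le_logb_of_le (by norm_num) hn' (le_div_self hn'.le hε hε₁)

/-- The number of levels is logarithmic. -/
theorem logb_level_le {n : ℕ} {c ε : ℝ} (hn : 2 ≤ n) (hc : 0 < c) (hc₁ : c ≤ 1) (hε : 0 < ε)
    (hε₁ : ε ≤ 1) :
    Real.logb 2 (16 * Real.logb 2 n ^ 2 * (Real.logb 2 n ^ 8 * √n / (c * ε ^ 2))) + 2 ≤
      (18 + Real.logb 2 c⁻¹) * Real.logb 2 (n / ε) := by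
  set L := Real.logb 2 n with hL
  have hn' : (0 : ℝ) < n := by positivity
  have hL₁ : 1 ≤ L := one_le_logb_two hn
  -- Since `n < 2 ^ n`, `L ≤ n`; taking logarithms gives the claim.
  have hLn : Real.logb 2 L ≤ L := by
    refine Real.logb_le_logb_of_le (by norm_num) (by linarith) ?_
    rw [hL, Real.logb_le_iff_le_rpow (by norm_num) hn', Real.rpow_natCast]
    exact_mod_cast Nat.lt_two_pow_self.le
  have hdiv : Real.logb 2 (n / ε) = L + Real.logb 2 ε⁻¹ := by
    rw [Real.logb_div hn'.ne' hε.ne', Real.logb_inv, sub_eq_add_neg]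
  have hLe := logb_le_logb_div hn hε hε₁
  have hc₀ : 0 ≤ Real.logb 2 c⁻¹ := Real.logb_nonneg (by norm_num) ((one_le_inv₀ hc).2 hc₁)
  have hexp : Real.logb 2 (16 * L ^ 2 * (L ^ 8 * √n / (c * ε ^ 2))) =
      4 + 10 * Real.logb 2 L + L / 2 + Real.logb 2 c⁻¹ + 2 * Real.logb 2 ε⁻¹ := by
    have h₁ : 16 * L ^ 2 * (L ^ 8 * √n / (c * ε ^ 2)) =
        2 ^ 4 * L ^ 10 * √n * c⁻¹ * ε⁻¹ ^ 2 := by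
      field_simp
      norm_num
    have hL0 : L ≠ 0 := by positivity
    have hs : √(n : ℝ) ≠ 0 := (Real.sqrt_pos.2 hn').ne'
    rw [h₁, Real.logb_mul (by positivity) (by positivity),
      Real.logb_mul (by positivity) (by positivity), Real.logb_mul (by positivity) hs,
      Real.logb_mul (by positivity) (by positivity), Real.logb_pow, Real.logb_pow, Real.logb_pow,
      Real.logb_self_eq_one (by norm_num), Real.sqrt_eq_rpow, Real.logb_rpow_eq_mul_logb_of_pos hn']
    push_cast
    ring
  rw [hexp]
  nlinarith [mul_nonneg hc₀ (sub_nonneg.2 (hL₁.trans hLe))]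

theorem exists_algorithm {c : ℝ} (hc : 0 < c) (hc₁ : c ≤ 1) {n : ℕ} {ε : ℝ} (hn : 2 ≤ n)
    (hε : 0 < ε) (hε₁ : ε ≤ 1) :
    ∃ A : QueryAlg n (Option (EdgePair n)), BuiltFromAESearch A ∧
      (A.queries : ℝ) ≤ 6272 / c * (18 + Real.logb 2 c⁻¹) * queryBound n ε ∧
      (∀ (f : Cube n → Bool) (v : EdgePair n), some v ∈ (A.run f).support → v.IsViolation f) ∧
      ∀ (Λ : ℕ) (f : Cube n → Bool), (2 : ℝ) ^ Λ ≤ √n → ScoreCondition c ε Λ f →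
        A.failure f ≤ 1 / 3 := by
  have hn' : (0 : ℝ) < n := by positivity
  have hs : 1 ≤ √(n : ℝ) := Real.one_le_sqrt.2 (by exact_mod_cast (by omega : 1 ≤ n))
  set L := Real.logb 2 n with hL
  have hL₁ : 1 ≤ L := one_le_logb_two hn
  -- `D` is `√n` divided by the right side of the score condition, so the total mean weight is at
  -- least `1 / (4 * D)`.
  set D : ℝ := L ^ 8 * √n / (c * ε ^ 2) with hDdef
  have hcε : 0 < c * ε ^ 2 := by positivity
  have hD₁ : 1 ≤ D := by
    rw [hDdef, one_le_div hcε]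
    exact (mul_le_one₀ hc₁ (by positivity) (pow_le_one₀ hε.le hε₁)).trans
      (one_le_mul_of_one_le_of_one_le (one_le_pow₀ hL₁) hs)
  have hD : 0 < D := zero_lt_one.trans_le hD₁
  set X : ℝ := 16 * L ^ 2 * D with hX
  have hX₁ : 1 ≤ X := by nlinarith [one_le_mul_of_one_le_of_one_le (one_le_pow₀ hL₁ (n := 2)) hD₁]
  -- The least number of levels with `2 ^ H ≥ X`: as there are at most `2 * L ^ 2` scale pairs,
  -- their total truncation error is at most `1 / (8 * D)`.
  set H : ℕ := ⌈Real.logb 2 X⌉₊ with hH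
  have hlogX : 0 ≤ Real.logb 2 X := Real.logb_nonneg (by norm_num) hX₁
  have hXH : X ≤ 2 ^ H := by
    rw [← Real.rpow_natCast, ← Real.logb_le_iff_le_rpow (by norm_num) (by linarith)]
    exact Nat.le_ceil _
  have hH₁ : (H : ℝ) < Real.logb 2 X + 1 := Nat.ceil_lt_add_one hlogX
  have hHX : (2 : ℝ) ^ H ≤ 32 * L ^ 2 * D := by
    have h₁ : (2 : ℝ) ^ (H : ℝ) ≤ 2 ^ (Real.logb 2 X + 1) :=
      Real.rpow_le_rpow_of_exponent_le (by norm_num) hH₁.le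
    rw [Real.rpow_natCast, Real.rpow_add (by norm_num), Real.rpow_one,
      Real.rpow_logb (by norm_num) (by norm_num) (by linarith), hX] at h₁
    linarith
  refine ⟨violationSearch n D H, builtFromAESearch_violationSearch n D H, ?_,
    fun f v => isViolation_of_mem_support_violationSearch, fun Λ f hΛ hf => ?_⟩
  · have hlevel : (H : ℝ) + 1 ≤ (18 + Real.logb 2 c⁻¹) * Real.logb 2 (n / ε) := by
      have := logb_level_le hn hc hc₁ hε hε₁
      linarith
    have hℓ : 1 ≤ Real.logb 2 (n / ε) := hL₁.trans (logb_le_logb_div hn hε hε₁)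
    have hc₀ : 0 ≤ Real.logb 2 c⁻¹ := Real.logb_nonneg (by norm_num) ((one_le_inv₀ hc).2 hc₁)
    refine (queries_violationSearch_le hn hD hHX).trans ?_
    calc 6272 * L ^ 5 * (D * √√(n : ℝ)) * (H + 1)
        ≤ 6272 * L ^ 5 * (D * √√(n : ℝ)) *
          ((18 + Real.logb 2 c⁻¹) * Real.logb 2 (n / ε)) := by gcongr
      _ = 6272 / c * (18 + Real.logb 2 c⁻¹) *
          ((√n * √√(n : ℝ)) / ε ^ 2 * L ^ 13 * Real.logb 2 (n / ε) ^ 1) := by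
        rw [hDdef]
        field_simp
      -- The analysis needs only `L ^ 13` and one factor `log (n / ε)`; the stated bound is weaker.
      _ ≤ 6272 / c * (18 + Real.logb 2 c⁻¹) * queryBound n ε := by
        rw [queryBound, rpow_three_div_four]
        gcongr <;> norm_num [hL₁, hℓ]
  · have hsum := hf.trans (sum_min_score_le f (by omega) hΛ)
    refine failure_violationSearch_le hD ?_ ?_
    · rw [div_le_iff₀ (by positivity)]
      rw [div_le_iff₀ (by positivity)] at hsum
      rw [hDdef]
      rw [mul_div_assoc', mul_div_assoc', le_div_iff₀ hcε]
      linarith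
    · have h₁ := card_scalePairs_le n
      rw [one_div, inv_pow, ← div_eq_mul_inv, div_le_div_iff₀ (by positivity) (by positivity)]
      calc ((scalePairs n).card : ℝ) * (8 * D) ≤ 2 * L ^ 2 * (8 * D) := by gcongr
        _ = X := by rw [hX]; ring
        _ ≤ 1 * 2 ^ H := by rw [one_mul]; exact hXH

theorem two_thirds_le_of_failure_le {n : ℕ} {f : Cube n → Bool}
    {A : QueryAlg n (Option (EdgePair n))} (hA : A.failure f ≤ 1 / 3)
    (hv : ∀ v : EdgePair n, some v ∈ (A.run f).support → v.IsViolation f) :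
    2 / 3 ≤ (A.run f).toOuterMeasure {o | ∃ v : EdgePair n, o = some v ∧ v.IsViolation f} := by
  classical
  rw [QueryAlg.toOuterMeasure_run, ENNReal.le_ofReal_iff_toReal_le
    (ENNReal.div_ne_top (by simp) (by simp)) (QueryAlg.expect_nonneg fun b => by split_ifs <;> simp),
    ENNReal.toReal_div, ENNReal.toReal_ofNat, ENNReal.toReal_ofNat]
  have h₁ : 1 - A.failure f = A.expect f fun o => 1 - if o.isSome then 0 else 1 := by
    rw [QueryAlg.expect_sub, QueryAlg.expect_const, QueryAlg.failure]
  have h₂ : (2 / 3 : ℝ) ≤ 1 - A.failure f := by linarith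
  refine h₂.trans (h₁.trans_le (QueryAlg.expect_mono_support fun o ho => ?_))
  cases o with
  | none => simp
  | some v =>
    rw [if_pos (show some v ∈ {o | ∃ v : EdgePair n, o = some v ∧ v.IsViolation f} from
      ⟨v, rfl, hv v ho⟩)]
    simp

/-- Both logarithms are at most `log (n / ε)`, and `log (n^(3/4) / ε²) = (3/4) log n + 2 log (1/ε)`
is at least `3/4` of it. -/
theorem queryBound_le {n : ℕ} {ε : ℝ} (hn : 2 ≤ n) (hε : 0 < ε) (hε₁ : ε ≤ 1) :
    queryBound n ε ≤ (4 / 3) ^ 18 * ((n : ℝ) ^ (3 / 4 : ℝ) / ε ^ 2) *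
      Real.logb 2 ((n : ℝ) ^ (3 / 4 : ℝ) / ε ^ 2) ^ 18 := by
  have hn' : (0 : ℝ) < n := by positivity
  have hL₁ : 1 ≤ Real.logb 2 n := one_le_logb_two hn
  have hℓ := logb_le_logb_div hn hε hε₁
  have hlog : Real.logb 2 (n / ε) ≤ 4 / 3 * Real.logb 2 ((n : ℝ) ^ (3 / 4 : ℝ) / ε ^ 2) := by
    have h₀ : Real.logb 2 ε ≤ 0 := Real.logb_nonpos (by norm_num) hε.le hε₁
    rw [Real.logb_div hn'.ne' hε.ne', Real.logb_div (by positivity) (by positivity),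
      Real.logb_rpow_eq_mul_logb_of_pos hn', Real.logb_pow]
    push_cast
    linarith
  calc queryBound n ε
      = (n : ℝ) ^ (3 / 4 : ℝ) / ε ^ 2 * (Real.logb 2 n ^ 16 * Real.logb 2 (n / ε) ^ 2) := by
        rw [queryBound]; ring
    _ ≤ (n : ℝ) ^ (3 / 4 : ℝ) / ε ^ 2 * (Real.logb 2 (n / ε) ^ 16 * Real.logb 2 (n / ε) ^ 2) := by
        gcongr
    _ = (n : ℝ) ^ (3 / 4 : ℝ) / ε ^ 2 * Real.logb 2 (n / ε) ^ 18 := by ring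
    _ ≤ (n : ℝ) ^ (3 / 4 : ℝ) / ε ^ 2 *
        (4 / 3 * Real.logb 2 ((n : ℝ) ^ (3 / 4 : ℝ) / ε ^ 2)) ^ 18 := by
        gcongr
        linarith
    _ = _ := by ring

theorem mainTheorem1 :
    (∀ c : ℝ, 0 < c → ∃ C : ℝ, 0 < C ∧
      ∀ (n : ℕ) (ε : ℝ), 2 ≤ n → 0 < ε → ε ≤ 1 →
        ∃ A : QueryAlg n (Option (EdgePair n)),
          BuiltFromAESearch A ∧
          (A.queries : ℝ) ≤ C * queryBound n ε ∧
          (∀ (f : Cube n → Bool) (v : EdgePair n), some v ∈ (A.run f).support → v.IsViolation f) ∧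
          (∀ (Λ : ℕ) (f : Cube n → Bool), (2 : ℝ) ^ Λ ≤ Real.sqrt n → ScoreCondition c ε Λ f →
            2 / 3 ≤ (A.run f).toOuterMeasure {o | ∃ v : EdgePair n, o = some v ∧ v.IsViolation f})) ∧
    (∃ (D : ℝ) (k : ℕ), 0 < D ∧ ∀ (n : ℕ) (ε : ℝ), 2 ≤ n → 0 < ε → ε ≤ 1 →
      queryBound n ε ≤
        D * ((n : ℝ) ^ (3 / 4 : ℝ) / ε ^ 2) * Real.logb 2 ((n : ℝ) ^ (3 / 4 : ℝ) / ε ^ 2) ^ k) := by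
  refine ⟨fun c hc => ?_, (4 / 3) ^ 18, 18, by positivity, fun n ε hn hε hε₁ =>
    queryBound_le hn hε hε₁⟩
  -- The score condition weakens as `c` decreases; `c' ≤ 1` ensures `D ≥ 1` and a nonnegative `log
  -- (1 / c')`.
  set c' := min c 1 with hc'
  have hc'₀ : 0 < c' := lt_min hc one_pos
  have hc'₁ : c' ≤ 1 := min_le_right c 1
  have hlog : 0 ≤ Real.logb 2 c'⁻¹ := Real.logb_nonneg (by norm_num) ((one_le_inv₀ hc'₀).2 hc'₁)
  refine ⟨6272 / c' * (18 + Real.logb 2 c'⁻¹), by positivity, fun n ε hn hε hε₁ => ?_⟩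
  obtain ⟨A, hA, hq, hv, hf⟩ := exists_algorithm hc'₀ hc'₁ hn hε hε₁
  refine ⟨A, hA, hq, hv, fun Λ f hΛ hscore => two_thirds_le_of_failure_le (hf Λ f hΛ ?_) (hv f)⟩
  have hL := one_le_logb_two hn
  refine le_trans ?_ hscore
  have : c' ≤ c := min_le_left c 1
  gcongr
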